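/- Let $A\in\mathbb R^{n\times n}$, $B\in\mathbb R^{n\times p}$, $C\in\mathbb R^{m\times n}$, $D\in\mathbb R^{m\times p}$, let $E\in\mathbb R^{(n+m)\times(n+m)}$ and $G\in\mathbb R^{(n+p)\times(n+p)}$ be diagonal with diagonal entries in $\{0,1\}$, let $s\in\mathbb C$, and let $$\Lambda_s=\begin{bmatrix}A-sI&B\\C&D\end{bmatrix}.$$ Let $\Lambda_s^\alpha$ consist of the $q$ rows of $\Lambda_s$ whose index $i$ has $E_{ii}=1$, and $\Lambda_s^\beta$ of the remaining rows. Let $J$ consist of the $r$ rows of the identity matrix $I_{n+p}$ whose index $i$ has $G_{ii}=1$. Let $Q_2\in\mathbb C^{(n+p)\times t}$ come from a QR decomposition $(\Lambda_s^\beta)^H=\begin{bmatrix}Q_1&Q_2\end{bmatrix}\begin{bmatrix}R_1\\0\end{bmatrix}$ with $\begin{bmatrix}Q_1&Q_2\end{bmatrix}$ unitary and $R_1$ of full row rank, so that the columns of $Q_2$ form an orthonormal basis of the null space of $\Lambda_s^\beta$. Put $Q_2^\alpha=JQ_2$. Assume that $Q_2^\alpha\neq0$, that $\operatorname{rank}\Lambda_s^\beta<n+p$,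 and that $t\le q$ (the last holds whenever $s$ is not already an invariant zero of the system, that is, whenever $\operatorname{rank}\Lambda_s=n+p$). Let $\delta=\min(q,t)$ be the smaller dimension of the $q\times t$ matrix $\Lambda_s^\alpha Q_2$. For a complex matrix $M$ and $\gamma\in(0,1]$ let $$\Pi(\gamma,M)=\begin{bmatrix}\operatorname{Re}M&-\gamma\operatorname{Im}M\\\gamma^{-1}\operatorname{Im}M&\operatorname{Re}M\end{bmatrix}.$$ For real matrices $X,Y$ with the same number of columns let $\sigma_i(X,Y)\in[0,\infty]$ be the $i$-th largest generalized singular value of the pair $(X,Y)$, that is, the $i$-th largest of the quotients $\alpha_j/\beta_j$ with $\alpha_j,\beta_j\ge0$ for which there is an invertible $Z$ with $(XZ)^T(XZ)=\operatorname{diag}(\alpha_j^2)$ and $(YZ)^T(YZ)=\operatorname{diag}(\beta_j^2)$, where $a/0=\infty$ for $a>0$ and $0/0=0$. Consider the problem $$\min\ \|\Delta\|\quad\text{over }\Delta\in\mathbb R^{q\times r}\text{ such that }\Delta\,Q_2^\alpha d=\Lambda_s^\alpha Q_2d\text{ for some }d\in\mathbb C^t\setminus\{0\},$$ where $\|\cdot\|$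 is the spectral norm. The infimum in this problem, taken in $[0,\infty]$ and equal to $\infty$ if no $\Delta$ satisfies the constraint, is $$\sup_{\gamma\in(0,1]}\sigma_{2\delta-1}\big(\Pi(\gamma,\Lambda_s^\alpha Q_2),\Pi(\gamma,Q_2^\alpha)\big).$$ The infimum is attained whenever some $\Delta$ satisfies the constraint, and every solution $\Delta_s^{*r}$ of the problem has $\|\Delta_s^{*r}\|$ equal to this supremum. -/

import Mathlib

open Matrix
open scoped ENNReal

noncomputable section

namespace OpacityPerturbation

/-- The spectral norm of a real matrix (operator norm for the Euclidean norms). -/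
def spectralNorm {a b : Type*} [Fintype a] [DecidableEq a] [Fintype b] [DecidableEq b]
    (Δ : Matrix a b ℝ) : ℝ :=
  ‖(Matrix.toEuclideanLin Δ).toContinuousLinearMap‖

/-- Diagonal matrices all of whose diagonal entries are `0` or `1`. -/
def IsBinaryDiagonal {a : Type*} (E : Matrix a a ℝ) : Prop :=
  E.IsDiag ∧ ∀ i, E i i = 0 ∨ E i i = 1

/-- The system pencil `Λ_s = [A - sI, B; C, D]`. -/
def pencil {n m p : ℕ} (A : Matrix (Fin n) (Fin n) ℝ) (B : Matrix (Fin n) (Fin p) ℝ)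
    (C : Matrix (Fin m) (Fin n) ℝ) (D : Matrix (Fin m) (Fin p) ℝ) (s : ℂ) :
    Matrix (Fin n ⊕ Fin m) (Fin n ⊕ Fin p) ℂ :=
  Matrix.fromBlocks (A.map Complex.ofReal - s • 1) (B.map Complex.ofReal)
    (C.map Complex.ofReal) (D.map Complex.ofReal)

/-- The indices selected by a binary diagonal matrix: the rows of `E * Δ * G` (for `E`), or the
columns of `E * Δ * G` (for `G`), that may be nonzero. -/
abbrev Selected {a : Type*} (E : Matrix a a ℝ) : Type _ := {i : a // E i i = 1}

/-- The indices not selected by a binary diagonal matrix. -/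
abbrev Unselected {a : Type*} (E : Matrix a a ℝ) : Type _ := {i : a // E i i = 0}

/-- `L^α`: the rows of `L` that can be perturbed. -/
def alphaPart {a b : Type*} (E : Matrix a a ℝ) (L : Matrix a b ℂ) : Matrix (Selected E) b ℂ :=
  L.submatrix Subtype.val id

/-- `L^β`: the remaining rows of `L`. -/
def betaPart {a b : Type*} (E : Matrix a a ℝ) (L : Matrix a b ℂ) : Matrix (Unselected E) b ℂ :=
  L.submatrix Subtype.val id

/-- The binary matrix `J` with `Δ^α = Δ^r J`: the rows of the identity selected by `G`, so that
multiplication by `J` on the right puts the deleted zero columns back. -/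
def selector {b : Type*} [DecidableEq b] (G : Matrix b b ℝ) : Matrix (Selected G) b ℂ :=
  (1 : Matrix b b ℂ).submatrix Subtype.val id

/-- `Lᴴ = [Q₁ Q₂] [R₁; 0]` with `[Q₁ Q₂]` unitary and `R₁` of full row rank, so that the columns
of `Q₂` are an orthonormal basis of the null space of `L`. The triangular shape of `R₁` plays no
role for `Q₂` and is not demanded. -/
structure IsQR {l b : Type*} [Fintype l] [Fintype b] [DecidableEq b] {k t : ℕ}
    (L : Matrix l b ℂ) (Q₁ : Matrix b (Fin k) ℂ) (Q₂ : Matrix b (Fin t) ℂ)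
    (R₁ : Matrix (Fin k) l ℂ) : Prop where
  conjTranspose_mul : (Matrix.fromCols Q₁ Q₂)ᴴ * Matrix.fromCols Q₁ Q₂ = 1
  mul_conjTranspose : Matrix.fromCols Q₁ Q₂ * (Matrix.fromCols Q₁ Q₂)ᴴ = 1
  factor : Lᴴ = Matrix.fromCols Q₁ Q₂ * Matrix.fromRows R₁ 0
  rank_eq : R₁.rank = k

/-- The real matrices `Δ` with `Δ N d = M d` for some nonzero complex vector `d`. -/
def feasible {q r t : Type*} [Fintype r] [Fintype t]
    (M : Matrix q t ℂ) (N : Matrix r t ℂ) : Set (Matrix q r ℝ) :=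
  {Δ | ∃ d : t → ℂ, d ≠ 0 ∧ (Δ.map Complex.ofReal * N) *ᵥ d = M *ᵥ d}

/-- `Δ` solves the problem of minimizing the spectral norm over `feasible M N`. -/
def IsSolution {q r t : Type*} [Fintype q] [DecidableEq q] [Fintype r] [DecidableEq r] [Fintype t]
    (M : Matrix q t ℂ) (N : Matrix r t ℂ) (Δ : Matrix q r ℝ) : Prop :=
  Δ ∈ feasible M N ∧ ∀ Δ' ∈ feasible M N, spectralNorm Δ ≤ spectralNorm Δ'

/-- The minimal norm, as an infimum in `[0, ∞]` (it is `∞` if there is no feasible matrix). -/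
def minNorm {q r t : Type*} [Fintype q] [DecidableEq q] [Fintype r] [DecidableEq r] [Fintype t]
    (M : Matrix q t ℂ) (N : Matrix r t ℂ) : ℝ≥0∞ :=
  ⨅ Δ ∈ feasible M N, ENNReal.ofReal (spectralNorm Δ)

/-- `Π(γ, M) = [Re M, -γ Im M; γ⁻¹ Im M, Re M]`. -/
def realBlock {q t : Type*} (γ : ℝ) (M : Matrix q t ℂ) : Matrix (q ⊕ q) (t ⊕ t) ℝ :=
  Matrix.fromBlocks (M.map Complex.re) (-(γ • M.map Complex.im))
    (γ⁻¹ • M.map Complex.im) (M.map Complex.re)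

/-- A generalized singular value decomposition of the pair `(A, B)`: `X` is invertible, the columns
of `A X` are pairwise orthogonal with Euclidean lengths `α j`, and those of `B X` are pairwise
orthogonal with lengths `β j`. (Normalizing the columns gives `A X = U diag(α)`,
`B X = V diag(β)`.) -/
structure IsGSVD {a b w : Type*} [Fintype a] [Fintype b] [Fintype w] [DecidableEq w]
    (A : Matrix a w ℝ) (B : Matrix b w ℝ) (X : Matrix w w ℝ) (α β : w → ℝ) : Prop where
  isUnit : IsUnit X
  left_nonneg : ∀ j, 0 ≤ α j
  right_nonneg : ∀ j, 0 ≤ β j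
  left_gram : (A * X)ᵀ * (A * X) = Matrix.diagonal fun j => α j ^ 2
  right_gram : (B * X)ᵀ * (B * X) = Matrix.diagonal fun j => β j ^ 2

/-- `σ_i(A, B)`: the `i`-th largest (counted from `1`, with multiplicity) of the generalized
singular values `α j / β j` of the pair `(A, B)`, i.e. the largest `τ` such that at least `i` of
these quotients are `≥ τ`. The quotients are taken in `[0, ∞]`, where `a / 0 = ∞` for `a > 0` and
`0 / 0 = 0`; they do not depend on the decomposition, up to order. -/
def gsv {a b w : Type*} [Fintype a] [Fintype b] [Fintype w] [DecidableEq w]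
    (i : ℕ) (A : Matrix a w ℝ) (B : Matrix b w ℝ) : ℝ≥0∞ :=
  sSup {τ | ∃ (X : Matrix w w ℝ) (α β : w → ℝ), IsGSVD A B X α β ∧
    i ≤ {j : w | τ ≤ ENNReal.ofReal (α j) / ENNReal.ofReal (β j)}.ncard}

end OpacityPerturbation

end

/-!
# Real perturbations and generalized singular values

Write `M = Lα Q₂` and `N = Q₂α`, and fix `ρ ≥ 0`. A real `Δ` with `‖Δ‖ ≤ ρ` and `Δ N d = M d` exists
if and only if every real combination of `Re (M d)` and `Im (M d)` is at most `ρ` times as long as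
the same combination of `Re (N d)` and `Im (N d)` (`exists_spectralNorm_le`). In terms of
`h(z) = ρ² |N z|² - |M z|²` and `c(z) = ρ² (N z)ᵀ(N z) - (M z)ᵀ(M z)` this says `|c(d)| ≤ h(d)`.
On the other hand `ρ² |Π(γ, N) x|² - |Π(γ, M) x|²` is, up to a positive factor, the real quadratic
form `h - κ Re c` at `z = a + iγb`, where `x = (a, b)` and `γ² = (1 - κ) / (1 + κ)`. The second
smallest generalized singular value of the pair is at most `ρ` exactly when this form is
nonnegative on some real plane (`gsv_le`, `exists_plane_of_gsv_le`).

If `|c(d)| ≤ h(d)`, then the complex line of `d` is such a plane for all `κ`, which is one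
inequality. For the other one has to find `d ≠ 0` with `|c(d)| ≤ h(d)` when every form `h - κ Re c`,
`0 ≤ κ < 1`, is nonnegative on some real plane (`exists_norm_le`). Suppose that there is none. Then
`c` has no zero but the origin on the nonnegative planes, so it has a winding number around the
origin on each of them, which is `±2` or `0` according to the sign of a discriminant
(`frameDisc`). For `κ = 0` there is a complex line among the planes, where it is `±2`. For `κ = 1`
it is always `0`, because `c` avoids the half-line `[0, ∞)` (`pencilDisc_pos`). By compactness and
connectedness of `[0, 1]` both cases occur for a common `κ`. This is absurd, since the nonnegative
planes of a single real quadratic form are connected to each other (`frameDisc_pos_iff`).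

Since `t ≤ q`, the index `2δ - 1 = 2t - 1` is that of the second smallest of the `2t` generalized
singular values. As the vector `d` is found at `ρ` equal to the supremum itself, the infimum is
attained as soon as the supremum is finite. A generalized singular value decomposition is only
constructed for pairs without a common null vector (`exists_isGSVD`); if `M` and `N` have one, then
`Δ = 0` solves the problem, and the upper bound `gsv_le` shows that the supremum is zero too.
-/

noncomputable section

namespace OpacityPerturbation

/-! ### Binary quadratic forms with complex coefficients -/

/-- For the complex-valued quadratic form `a x² + 2 e x y + c y²` of two real variables, the
maximum over unit complex `ζ` of twice the determinant of the real form
`Re (ζ (a x² + 2exy + cy²))`. If the form has no real zero, a positive value says that its image is contained in an open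
half-plane, a negative one that its image winds around the origin. -/
def pencilDisc (a e c : ℂ) : ℝ :=
  ‖a * c - e ^ 2‖ + (a * (starRingEnd ℂ) c).re - ‖e‖ ^ 2

/-- The value at `(x, y)` of the quadratic form `a x² + 2 e x y + c y²`, with real `x`, `y` and
complex coefficients. -/
def binaryForm (a e c : ℂ) (x y : ℝ) : ℂ :=
  (x : ℂ) ^ 2 * a + 2 * x * y * e + (y : ℂ) ^ 2 * c

lemma exists_binaryForm_eq_zero_of_real {a e c : ℂ} (him : (a * c - e ^ 2).im = 0)
    (hre : 0 ≤ (a * c - e ^ 2).re) (hdet : a.re * c.re = e.re ^ 2) :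
    ∃ x y : ℝ, (x ≠ 0 ∨ y ≠ 0) ∧ binaryForm a e c x y = 0 := by
  obtain ⟨a1, a2⟩ := a
  obtain ⟨e1, e2⟩ := e
  obtain ⟨c1, c2⟩ := c
  simp only [pow_two, Complex.sub_im, Complex.mul_im, Complex.sub_re, Complex.mul_re]
    at him hre hdet
  have key : ∀ x y : ℝ, a1 * x ^ 2 + 2 * e1 * x * y + c1 * y ^ 2 = 0 →
      a2 * x ^ 2 + 2 * e2 * x * y + c2 * y ^ 2 = 0 →
      binaryForm ⟨a1, a2⟩ ⟨e1, e2⟩ ⟨c1, c2⟩ x y = 0 := by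
    intro x y h1 h2
    apply Complex.ext
    · simp [binaryForm, pow_two]; linarith
    · simp [binaryForm, pow_two]; linarith
  -- The real part of the form is degenerate: use its kernel, unless that part vanishes.
  by_cases ha : a1 = 0
  · have he : e1 = 0 := by
      subst ha; nlinarith [sq_nonneg e1]
    subst ha he
    by_cases hc : c1 = 0
    · subst hc
      by_cases ha2 : a2 = 0
      · exact ⟨1, 0, by simp, key _ _ (by ring) (by subst ha2; ring)⟩
      · have hd : 0 ≤ e2 ^ 2 - a2 * c2 := by nlinarith
        refine ⟨-e2 + Real.sqrt (e2 ^ 2 - a2 * c2), a2, by simp [ha2], key _ _ (by ring) ?_⟩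
        have := Real.sq_sqrt hd
        linear_combination a2 * this
    · refine ⟨1, 0, by simp, key _ _ (by ring) ?_⟩
      have : a2 * c1 = 0 := by linarith
      have : a2 = 0 := by simpa [hc] using this
      subst this; ring
  · refine ⟨e1, -a1, by simp [ha], key _ _ ?_ ?_⟩
    · linear_combination a1 * hdet
    · linear_combination (-a2) * hdet + a1 * him

lemma binaryForm_mul (ζ a e c : ℂ) (x y : ℝ) :
    binaryForm (ζ * a) (ζ * e) (ζ * c) x y = ζ * binaryForm a e c x y := by
  simp only [binaryForm]; ring

lemma exists_binaryForm_eq_zero {a e c : ℂ} (h : pencilDisc a e c = 0) :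
    ∃ x y : ℝ, (x ≠ 0 ∨ y ≠ 0) ∧ binaryForm a e c x y = 0 := by
  -- A unit `ζ` attaining the maximum makes `ζ²(ac - e²)` a nonnegative real number.
  obtain ⟨ζ, hζ, hX⟩ : ∃ ζ : ℂ, ‖ζ‖ = 1 ∧
      ζ ^ 2 * (a * c - e ^ 2) = (‖a * c - e ^ 2‖ : ℂ) := by
    generalize a * c - e ^ 2 = X
    by_cases hX : X = 0
    · exact ⟨1, by simp, by simp [hX]⟩
    · obtain ⟨ζ, hζ⟩ := IsAlgClosed.exists_pow_nat_eq ((‖X‖ : ℂ) / X) (n := 2) (by norm_num)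
      refine ⟨ζ, ?_, by rw [hζ]; field_simp⟩
      have : ‖ζ‖ ^ 2 = 1 := by
        rw [← norm_pow, hζ]; simp [hX]
      nlinarith [norm_nonneg ζ]
  have hz : ζ ≠ 0 := by rintro rfl; simp at hζ
  have hX' : ζ * a * (ζ * c) - (ζ * e) ^ 2 = (‖a * c - e ^ 2‖ : ℂ) := by
    rw [← hX]; ring
  have h1 : ζ * (starRingEnd ℂ) ζ = 1 := by
    rw [Complex.mul_conj, Complex.normSq_eq_norm_sq, hζ]; simp
  obtain ⟨x, y, hxy, h0⟩ := exists_binaryForm_eq_zero_of_real (a := ζ * a) (e := ζ * e)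
    (c := ζ * c) (by rw [hX']; simp) (by rw [hX']; simp) (by
      have h2 : (ζ * a * (starRingEnd ℂ) (ζ * c)).re = (a * (starRingEnd ℂ) c).re := by
        congr 1
        rw [map_mul]; linear_combination (a * (starRingEnd ℂ) c) * h1
      have h3 : ‖ζ * e‖ ^ 2 = ‖e‖ ^ 2 := by rw [norm_mul, hζ, one_mul]
      have h4 := congrArg Complex.re hX'
      rw [Complex.ofReal_re] at h4
      rw [pencilDisc, ← h2, ← h3, ← h4, ← Complex.normSq_eq_norm_sq, Complex.normSq_apply] at h
      simp only [pow_two, Complex.sub_re, Complex.mul_re, Complex.conj_re, Complex.conj_im,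
        Complex.mul_im] at h ⊢
      linarith)
  refine ⟨x, y, hxy, ?_⟩
  rw [binaryForm_mul] at h0
  exact (mul_eq_zero.1 h0).resolve_left hz

/-- Under a real change of the two variables, `pencilDisc` is multiplied by the square of the
determinant, like each of the determinants of which it is the maximum. -/
lemma pencilDisc_change (a e c : ℂ) (x y z w : ℝ) :
    pencilDisc (binaryForm a e c x y)
      ((x * z : ℝ) * a + (x * w + y * z : ℝ) * e + (y * w : ℝ) * c) (binaryForm a e c z w) =
      (x * w - y * z) ^ 2 * pencilDisc a e c := by
  have h1 : binaryForm a e c x y * binaryForm a e c z w -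
      ((x * z : ℝ) * a + (x * w + y * z : ℝ) * e + (y * w : ℝ) * c) ^ 2 =
      (((x * w - y * z) ^ 2 : ℝ) : ℂ) * (a * c - e ^ 2) := by
    simp only [binaryForm]; push_cast; ring
  rw [pencilDisc, h1, norm_mul, Complex.norm_real, Real.norm_of_nonneg (sq_nonneg _), pencilDisc,
    ← Complex.normSq_eq_norm_sq, ← Complex.normSq_eq_norm_sq, Complex.normSq_apply,
    Complex.normSq_apply]
  simp only [binaryForm, pow_two, Complex.mul_re, Complex.add_re, Complex.add_im, Complex.mul_im,
    Complex.conj_re, Complex.conj_im, Complex.ofReal_re, Complex.ofReal_im, Complex.re_ofNat,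
    Complex.im_ofNat]
  ring

/-- A form that avoids the half-line `[0, ∞)` can be deformed to `-(x² + y²)` without acquiring
a zero. -/
lemma pencilDisc_pos {a e c : ℂ}
    (h : ∀ x y : ℝ, (x ≠ 0 ∨ y ≠ 0) → (binaryForm a e c x y).im = 0 →
      (binaryForm a e c x y).re < 0) : 0 < pencilDisc a e c := by
  set F : ℝ → ℝ := fun τ => pencilDisc ((1 - τ : ℝ) * a - τ) ((1 - τ : ℝ) * e)
    ((1 - τ : ℝ) * c - τ) with hF
  have hcont : Continuous F := by
    simp only [hF, pencilDisc]; fun_prop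
  have h0 : F 0 = pencilDisc a e c := by simp [hF]
  have h1 : 0 < F 1 := by simp [hF, pencilDisc]
  have hne : ∀ τ ∈ Set.Icc (0 : ℝ) 1, F τ ≠ 0 := by
    intro τ hτ h2
    obtain ⟨x, y, hxy, h3⟩ := exists_binaryForm_eq_zero h2
    have h4 : binaryForm ((1 - τ : ℝ) * a - τ) ((1 - τ : ℝ) * e) ((1 - τ : ℝ) * c - τ) x y =
        (1 - τ : ℝ) * binaryForm a e c x y - (τ * (x ^ 2 + y ^ 2) : ℝ) := by
      simp only [binaryForm]; push_cast; ring
    have hpos : 0 < x ^ 2 + y ^ 2 := by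
      rcases hxy with hx | hy <;> positivity
    rw [h4] at h3
    have hre := congrArg Complex.re h3
    have him := congrArg Complex.im h3
    rw [Complex.sub_re, Complex.re_ofReal_mul, Complex.ofReal_re, Complex.zero_re] at hre
    rw [Complex.sub_im, Complex.im_ofReal_mul, Complex.ofReal_im, Complex.zero_im, sub_zero] at him
    rcases eq_or_lt_of_le hτ.2 with rfl | hlt
    · nlinarith
    · have hm : 0 < 1 - τ := by linarith
      have := h x y hxy ((mul_eq_zero.1 him).resolve_left hm.ne')
      nlinarith [mul_nonneg hτ.1 hpos.le]
  by_contra hneg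
  rw [not_lt, ← h0] at hneg
  obtain ⟨τ, hτ, hτ0⟩ := intermediate_value_Icc (zero_le_one' ℝ) hcont.continuousOn
    (show (0 : ℝ) ∈ Set.Icc (F 0) (F 1) from ⟨hneg, h1.le⟩)
  exact hne τ hτ hτ0

/-! ### Nonnegative planes of a real quadratic form -/

section Frames

variable {V : Type*} [NormedAddCommGroup V] [InnerProductSpace ℝ V]

/-- The vectors `u`, `v` are linearly independent and `q` is nonnegative on the plane that they
span. -/
structure IsNonnegFrame (q : LinearMap.BilinForm ℝ V) (u v : V) : Prop where
  indep : ∀ x y : ℝ, x • u + y • v = 0 → x = 0 ∧ y = 0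
  nonneg : ∀ x y : ℝ, 0 ≤ q (x • u + y • v) (x • u + y • v)

/-- `pencilDisc` of the restriction to the plane spanned by `u` and `v` of a complex-valued
quadratic form. -/
def frameDisc (c : V →ₗ[ℝ] V →ₗ[ℝ] ℂ) (u v : V) : ℝ :=
  pencilDisc (c u u) (c u v) (c v v)

lemma apply_combination {c : V →ₗ[ℝ] V →ₗ[ℝ] ℂ} (hc : ∀ v w, c v w = c w v) (u v : V)
    (x y z w : ℝ) : c (x • u + y • v) (z • u + w • v) =
      (x * z : ℝ) * c u u + (x * w + y * z : ℝ) * c u v + (y * w : ℝ) * c v v := by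
  simp only [map_add, map_smul, LinearMap.add_apply, LinearMap.smul_apply, hc v u,
    Complex.real_smul]
  push_cast; ring

lemma apply_combination_self {c : V →ₗ[ℝ] V →ₗ[ℝ] ℂ} (hc : ∀ v w, c v w = c w v) (u v : V)
    (x y : ℝ) : c (x • u + y • v) (x • u + y • v) =
      binaryForm (c u u) (c u v) (c v v) x y := by
  rw [apply_combination hc, binaryForm]; push_cast; ring

lemma frameDisc_combination {c : V →ₗ[ℝ] V →ₗ[ℝ] ℂ} (hc : ∀ v w, c v w = c w v) (u v : V)
    (x y z w : ℝ) : frameDisc c (x • u + y • v) (z • u + w • v) =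
      (x * w - y * z) ^ 2 * frameDisc c u v := by
  rw [frameDisc, apply_combination_self hc, apply_combination_self hc, apply_combination hc,
    pencilDisc_change, frameDisc]

lemma frameDisc_swap {c : V →ₗ[ℝ] V →ₗ[ℝ] ℂ} (hc : ∀ v w, c v w = c w v) (u v : V) :
    frameDisc c v u = frameDisc c u v := by
  have := frameDisc_combination hc u v 0 1 1 0
  simpa using this

lemma IsNonnegFrame.combination {q : LinearMap.BilinForm ℝ V} {u v : V}
    (hf : IsNonnegFrame q u v) {x y z w : ℝ} (hdet : x * w - y * z ≠ 0) :
    IsNonnegFrame q (x • u + y • v) (z • u + w • v) := by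
  have key : ∀ r s : ℝ, r • (x • u + y • v) + s • (z • u + w • v) =
      (r * x + s * z) • u + (r * y + s * w) • v := by
    intro r s; module
  refine ⟨fun r s h => ?_, fun r s => ?_⟩
  · rw [key] at h
    obtain ⟨h1, h2⟩ := hf.indep _ _ h
    constructor
    · refine (mul_eq_zero.1 (?_ : r * (x * w - y * z) = 0)).resolve_right hdet
      linear_combination w * h1 - z * h2
    · refine (mul_eq_zero.1 (?_ : s * (x * w - y * z) = 0)).resolve_right hdet
      linear_combination x * h2 - y * h1
  · rw [key]; exact hf.nonneg _ _

/-- Every nonnegative plane has an orthonormal basis. -/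
lemma IsNonnegFrame.exists_orthonormal {q : LinearMap.BilinForm ℝ V} {u v : V}
    (hf : IsNonnegFrame q u v) : ∃ x y z w : ℝ, x * w - y * z ≠ 0 ∧
      ‖x • u + y • v‖ = 1 ∧ ‖z • u + w • v‖ = 1 ∧ inner ℝ (x • u + y • v) (z • u + w • v) = 0 := by
  have hu : u ≠ 0 := by
    rintro rfl
    have := (hf.indep 1 0 (by simp)).1
    norm_num at this
  have hu' : ‖u‖ ≠ 0 := norm_ne_zero_iff.2 hu
  set μ : ℝ := inner ℝ u v / ‖u‖ ^ 2 with hμ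
  have hr : v - μ • u ≠ 0 := by
    intro h0
    have := (hf.indep (-μ) 1 (by rw [← h0]; module)).2
    norm_num at this
  have hr' : ‖v - μ • u‖ ≠ 0 := norm_ne_zero_iff.2 hr
  have e1 : ‖u‖⁻¹ • u + (0 : ℝ) • v = ‖u‖⁻¹ • u := by simp
  have e2 : (-‖v - μ • u‖⁻¹ * μ) • u + ‖v - μ • u‖⁻¹ • v = ‖v - μ • u‖⁻¹ • (v - μ • u) := by
    module
  refine ⟨‖u‖⁻¹, 0, -‖v - μ • u‖⁻¹ * μ, ‖v - μ • u‖⁻¹, ?_, ?_, ?_, ?_⟩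
  · simpa using ⟨hu, hr⟩
  · rw [e1, norm_smul, norm_inv, norm_norm, inv_mul_cancel₀ hu']
  · rw [e2, norm_smul, norm_inv, norm_norm, inv_mul_cancel₀ hr']
  · rw [e1, e2, real_inner_smul_left, real_inner_smul_right, inner_sub_right,
      real_inner_smul_right, real_inner_self_eq_norm_sq, hμ]
    field_simp
    ring

lemma frameDisc_ne_zero {q : LinearMap.BilinForm ℝ V} {c : V →ₗ[ℝ] V →ₗ[ℝ] ℂ}
    (hc : ∀ v w, c v w = c w v) (hq : ∀ w, 0 ≤ q w w → c w w = 0 → w = 0) {u v : V}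
    (hf : IsNonnegFrame q u v) : frameDisc c u v ≠ 0 := by
  intro h
  obtain ⟨x, y, hxy, h0⟩ := exists_binaryForm_eq_zero h
  rw [← apply_combination_self hc] at h0
  obtain ⟨h1, h2⟩ := hf.indep _ _ (hq _ (hf.nonneg x y) h0)
  rcases hxy with h | h
  · exact h h1
  · exact h h2

variable [FiniteDimensional ℝ V]

lemma continuous_bilin {W X : Type*} [NormedAddCommGroup W] [NormedSpace ℝ W]
    [FiniteDimensional ℝ W] [TopologicalSpace X]
    (c : V →ₗ[ℝ] V →ₗ[ℝ] W) {u v : X → V} (hu : Continuous u) (hv : Continuous v) :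
    Continuous fun x => c (u x) (v x) := by
  have : ∀ x, c (u x) (v x) = c.toContinuousBilinearMap (u x) (v x) := fun x => rfl
  simp only [this]
  exact (c.toContinuousBilinearMap.continuous.comp hu).clm_apply hv

lemma continuous_frameDisc {X : Type*} [TopologicalSpace X] (c : V →ₗ[ℝ] V →ₗ[ℝ] ℂ)
    {u v : X → V} (hu : Continuous u) (hv : Continuous v) :
    Continuous fun x => frameDisc c (u x) (v x) := by
  have h1 := continuous_bilin c hu hu
  have h2 := continuous_bilin c hu hv
  have h3 := continuous_bilin c hv hv
  exact (((h1.mul h3).sub (h2.pow 2)).norm.add (Complex.continuous_re.comp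
    (h1.mul (Complex.continuous_conj.comp h3)))).sub (h2.norm.pow 2)

lemma frameDisc_pos_iff_of_path {q : LinearMap.BilinForm ℝ V} {c : V →ₗ[ℝ] V →ₗ[ℝ] ℂ}
    (hc : ∀ v w, c v w = c w v) (hq : ∀ w, 0 ≤ q w w → c w w = 0 → w = 0) {u v : ℝ → V}
    (hu : Continuous u) (hv : Continuous v)
    (hf : ∀ τ ∈ Set.Icc (0 : ℝ) 1, IsNonnegFrame q (u τ) (v τ)) :
    0 < frameDisc c (u 0) (v 0) ↔ 0 < frameDisc c (u 1) (v 1) := by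
  have hcont := (continuous_frameDisc c hu hv).continuousOn (s := Set.Icc (0 : ℝ) 1)
  have hne : ∀ τ ∈ Set.Icc (0 : ℝ) 1, frameDisc c (u τ) (v τ) ≠ 0 := fun τ hτ =>
    frameDisc_ne_zero hc hq (hf τ hτ)
  constructor
  · intro h
    by_contra h1
    obtain ⟨τ, hτ, h2⟩ := intermediate_value_Icc' (zero_le_one' ℝ) hcont ⟨not_lt.1 h1, h.le⟩
    exact hne τ hτ h2
  · intro h
    by_contra h1
    obtain ⟨τ, hτ, h2⟩ := intermediate_value_Icc (zero_le_one' ℝ) hcont ⟨not_lt.1 h1, h.le⟩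
    exact hne τ hτ h2

/-- The projection onto a maximal nonnegative subspace along a `q`-orthogonal complement on which
`q` is negative definite. -/
lemma exists_nonneg_projection {q : LinearMap.BilinForm ℝ V} (hq : ∀ v w, q v w = q w v) :
    ∃ P : V →ₗ[ℝ] V, (∀ x, P (P x) = P x) ∧ (∀ x, q (P x) (x - P x) = 0) ∧
      (∀ x, 0 ≤ q (P x) (P x)) ∧ (∀ x, q (x - P x) (x - P x) ≤ 0) ∧
      ∀ x, 0 ≤ q (x - P x) (x - P x) → x - P x = 0 := by
  obtain ⟨b, hb⟩ := LinearMap.BilinForm.exists_orthogonal_basis (B := q) ⟨fun v w => hq v w⟩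
  have hrepr : ∀ x y, q x y = ∑ i, b.repr x i * b.repr y i * q (b i) (b i) := by
    intro x y
    conv_lhs => rw [← b.sum_repr x, ← b.sum_repr y]
    simp only [map_sum, LinearMap.sum_apply, map_smul, LinearMap.smul_apply, smul_eq_mul]
    refine Finset.sum_congr rfl fun i _ => ?_
    rw [Finset.sum_eq_single i]
    · ring
    · intro j _ hji
      have : q (b j) (b i) = 0 := hb hji
      simp [this]
    · simp
  set P : V →ₗ[ℝ] V := b.constr ℝ (fun i => if 0 ≤ q (b i) (b i) then b i else 0) with hP
  have hPr : ∀ x i, b.repr (P x) i = if 0 ≤ q (b i) (b i) then b.repr x i else 0 := by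
    intro x i
    rw [hP, Module.Basis.constr_apply_fintype, map_sum, Finset.sum_apply']
    rw [Finset.sum_eq_single i]
    · by_cases h : 0 ≤ q (b i) (b i) <;> simp [h]
    · intro j _ hji
      by_cases h : 0 ≤ q (b j) (b j) <;> simp [h, hji]
    · simp
  refine ⟨P, fun x => ?_, fun x => ?_, fun x => ?_, fun x => ?_, fun x hx => ?_⟩
  · apply b.repr.injective
    ext i
    simp only [hPr]
    split_ifs <;> rfl
  · rw [hrepr]
    refine Finset.sum_eq_zero fun i _ => ?_
    simp only [map_sub, Finsupp.sub_apply, hPr]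
    split_ifs <;> simp
  · rw [hrepr]
    refine Finset.sum_nonneg fun i _ => ?_
    simp only [hPr]
    split_ifs with h
    · exact mul_nonneg (mul_self_nonneg _) h
    · simp
  · rw [hrepr]
    refine Finset.sum_nonpos fun i _ => ?_
    simp only [map_sub, Finsupp.sub_apply, hPr]
    split_ifs with h
    · simp
    · exact mul_nonpos_of_nonneg_of_nonpos (mul_self_nonneg _) (not_le.1 h).le
  · rw [hrepr] at hx
    have hterm : ∀ i ∈ Finset.univ, 0 ≤ -(b.repr (x - P x) i * b.repr (x - P x) i *
        q (b i) (b i)) := by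
      intro i _
      simp only [map_sub, Finsupp.sub_apply, hPr]
      split_ifs with h
      · simp
      · exact neg_nonneg.2 (mul_nonpos_of_nonneg_of_nonpos (mul_self_nonneg _) (not_le.1 h).le)
    have hsum : ∑ i, -(b.repr (x - P x) i * b.repr (x - P x) i * q (b i) (b i)) = 0 :=
      le_antisymm (by rw [Finset.sum_neg_distrib]; linarith) (Finset.sum_nonneg hterm)
    apply b.repr.injective
    ext i
    have := (Finset.sum_eq_zero_iff_of_nonneg hterm).1 hsum i (Finset.mem_univ i)
    rw [neg_eq_zero, mul_eq_zero] at this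
    by_cases h : 0 ≤ q (b i) (b i)
    · simp [hPr, h]
    · simpa using this.resolve_right (fun h0 => h h0.ge)

/-- Planes in a subspace on which `q` is nonnegative: one basis vector is exchanged at a time. -/
lemma frameDisc_pos_iff_of_common {q : LinearMap.BilinForm ℝ V} {c : V →ₗ[ℝ] V →ₗ[ℝ] ℂ}
    (hc : ∀ v w, c v w = c w v) (hq : ∀ w, 0 ≤ q w w → c w w = 0 → w = 0) {a b b' : V}
    (hs : ∀ x y z : ℝ, 0 ≤ q (x • a + y • b + z • b') (x • a + y • b + z • b'))
    (h1 : ∀ x y : ℝ, x • a + y • b = 0 → x = 0 ∧ y = 0)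
    (h2 : ∀ x y : ℝ, x • a + y • b' = 0 → x = 0 ∧ y = 0) :
    0 < frameDisc c a b ↔ 0 < frameDisc c a b' := by
  by_cases hb : ∃ x y : ℝ, b' = x • a + y • b
  · obtain ⟨x, y, rfl⟩ := hb
    have hy : y ≠ 0 := by
      rintro rfl
      have := (h2 (-x) 1 (by module)).2
      norm_num at this
    have h3 := frameDisc_combination hc a b 1 0 x y
    simp only [one_smul, zero_smul, add_zero, one_mul, zero_mul, sub_zero] at h3
    have hy2 : 0 < y ^ 2 := by positivity
    rw [h3, mul_pos_iff_of_pos_left hy2]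
  · push Not at hb
    have h3 := frameDisc_pos_iff_of_path hc hq (u := fun _ => a)
      (v := fun τ => (1 - τ) • b + τ • b') continuous_const (by fun_prop) (fun τ _ => by
        refine ⟨fun x y h0 => ?_, fun x y => ?_⟩
        · have hyτ : y * τ = 0 := by
            by_contra hne
            refine hb (-x / (y * τ)) (-(y * (1 - τ)) / (y * τ)) ?_
            have h4 : (y * τ) • b' = (-x) • a + (-(y * (1 - τ))) • b := by
              rw [← sub_eq_zero, ← h0]; module
            have h5 : b' = (y * τ)⁻¹ • (y * τ) • b' := by
              rw [smul_smul, inv_mul_cancel₀ hne, one_smul]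
            rw [h5, h4, smul_add, smul_smul, smul_smul]
            congr 2 <;> ring
          have h6 : x • a + (y * (1 - τ)) • b = 0 := by
            have h7 : x • a + y • ((1 - τ) • b + τ • b') =
              x • a + (y * (1 - τ)) • b + (y * τ) • b' := by module
            rw [h7, hyτ, zero_smul, add_zero] at h0
            exact h0
          obtain ⟨h8, h9⟩ := h1 _ _ h6
          exact ⟨h8, by linarith⟩
        · have := hs x (y * (1 - τ)) (y * τ)
          have h5 : x • a + y • ((1 - τ) • b + τ • b') =
            x • a + (y * (1 - τ)) • b + (y * τ) • b' := by module
          rw [h5]; exact this)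
    simpa using h3

/-- For fixed `q` the sign of `frameDisc` is the same on all nonnegative planes: they can all be
moved into one maximal nonnegative subspace, where any two of them are connected. -/
lemma frameDisc_pos_iff {q : LinearMap.BilinForm ℝ V} (hqs : ∀ v w, q v w = q w v)
    {c : V →ₗ[ℝ] V →ₗ[ℝ] ℂ} (hc : ∀ v w, c v w = c w v)
    (hq : ∀ w, 0 ≤ q w w → c w w = 0 → w = 0) {u v u' v' : V}
    (hf : IsNonnegFrame q u v) (hf' : IsNonnegFrame q u' v') :
    0 < frameDisc c u v ↔ 0 < frameDisc c u' v' := by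
  obtain ⟨P, hPP, hort, hpos, hneg, hdef⟩ := exists_nonneg_projection hqs
  have hPsub : ∀ w, P (w - P w) = 0 := fun w => by rw [map_sub, hPP, sub_self]
  have hval : ∀ w (s : ℝ), q (P w + s • (w - P w)) (P w + s • (w - P w)) =
      q (P w) (P w) + s ^ 2 * q (w - P w) (w - P w) := by
    intro w s
    have h1 : q (w - P w) (P w) = 0 := by rw [hqs, hort]
    simp only [map_add, map_smul, LinearMap.add_apply, LinearMap.smul_apply, smul_eq_mul, hort, h1]
    ring
  have shrink : ∀ {u v : V}, IsNonnegFrame q u v →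
      (0 < frameDisc c u v ↔ 0 < frameDisc c (P u) (P v)) ∧
      ∀ x y : ℝ, x • P u + y • P v = 0 → x = 0 ∧ y = 0 := by
    intro u v hf
    have hfr : ∀ τ ∈ Set.Icc (0 : ℝ) 1,
        IsNonnegFrame q (P u + (1 - τ) • (u - P u)) (P v + (1 - τ) • (v - P v)) := by
      intro τ hτ
      have hcomb : ∀ x y : ℝ, x • (P u + (1 - τ) • (u - P u)) + y • (P v + (1 - τ) • (v - P v)) =
          P (x • u + y • v) + (1 - τ) • ((x • u + y • v) - P (x • u + y • v)) := by
        intro x y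
        rw [map_add, map_smul, map_smul]; module
      refine ⟨fun x y h0 => ?_, fun x y => ?_⟩
      · rw [hcomb] at h0
        have h1 := congrArg P h0
        rw [map_add, map_smul, hPP, hPsub, smul_zero, add_zero, map_zero] at h1
        have h2 := hdef (x • u + y • v)
        rw [h1, sub_zero] at h2
        exact hf.indep _ _ (h2 (hf.nonneg _ _))
      · rw [hcomb, hval]
        have h1 := hval (x • u + y • v) 1
        rw [one_smul, add_sub_cancel] at h1
        have h2 := hf.nonneg x y
        have h3 := hneg (x • u + y • v)
        have h4 : (1 - τ) ^ 2 ≤ 1 := by nlinarith [hτ.1, hτ.2]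
        nlinarith
    constructor
    · have h := frameDisc_pos_iff_of_path hc hq (by fun_prop) (by fun_prop) hfr
      simpa using h
    · intro x y h0
      have := (hfr 1 ⟨zero_le_one, le_rfl⟩).indep x y
      simp only [sub_self, zero_smul, add_zero] at this
      exact this h0
  obtain ⟨h1, i1⟩ := shrink hf
  obtain ⟨h2, i2⟩ := shrink hf'
  have hs : ∀ a b b' : V, ∀ x y z : ℝ, 0 ≤ q (x • P a + y • P b + z • P b')
      (x • P a + y • P b + z • P b') := by
    intro a b b' x y z
    have := hpos (x • a + y • b + z • b')
    simpa only [map_add, map_smul] using this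
  have iswap : ∀ {a b : V}, (∀ x y : ℝ, x • a + y • b = 0 → x = 0 ∧ y = 0) →
      ∀ x y : ℝ, x • b + y • a = 0 → x = 0 ∧ y = 0 := fun h x y h0 =>
    (h y x (by rw [add_comm]; exact h0)).symm
  have main : ∀ {a b a' b' : V}, (∀ x y : ℝ, x • P a + y • P b = 0 → x = 0 ∧ y = 0) →
      (∀ x y : ℝ, x • P a' + y • P b' = 0 → x = 0 ∧ y = 0) →
      (∀ x y : ℝ, x • P a + y • P a' = 0 → x = 0 ∧ y = 0) →
      (0 < frameDisc c (P a) (P b) ↔ 0 < frameDisc c (P a') (P b')) := by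
    intro a b a' b' hab hab' haa
    rw [frameDisc_pos_iff_of_common hc hq (hs a b a') hab haa, ← frameDisc_swap hc,
      frameDisc_pos_iff_of_common hc hq (hs a' a b') (iswap haa) hab']
  rw [h1, h2]
  by_cases haa : ∀ x y : ℝ, x • P u + y • P u' = 0 → x = 0 ∧ y = 0
  · exact main i1 i2 haa
  · -- Here `P u'` is a multiple of `P u`, hence independent of `P v`.
    rw [← frameDisc_swap hc]
    refine main (iswap i1) i2 fun x y h0 => ?_
    push Not at haa
    obtain ⟨r, s, h3, h4⟩ := haa
    have hs0 : s ≠ 0 := by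
      rintro rfl
      by_cases hr : r = 0
      · exact h4 hr rfl
      · have := (i1 r 0 (by simpa using h3)).1
        exact hr this
    have h5 : (-(y * r)) • P u + (x * s) • P v = 0 := by
      have : (-(y * r)) • P u + (x * s) • P v =
        s • (x • P v + y • P u') - y • (r • P u + s • P u') := by module
      rw [this, h0, h3, smul_zero, smul_zero, sub_zero]
    have hx : x = 0 := (mul_eq_zero.1 (i1 _ _ h5).2).resolve_right hs0
    subst hx
    refine ⟨rfl, ?_⟩
    exact (i2 y 0 (by simpa using h0)).1

end Frames

/-! ### From nonnegative real planes to a nonnegative complex line -/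

section Pencil

variable {V : Type*} [NormedAddCommGroup V] [InnerProductSpace ℝ V]

/-- The real bilinear form `h - κ Re c`. -/
def twisted (h : LinearMap.BilinForm ℝ V) (c : V →ₗ[ℝ] V →ₗ[ℝ] ℂ) (κ : ℝ) :
    LinearMap.BilinForm ℝ V :=
  h - κ • c.compr₂ Complex.reLm

lemma twisted_apply (h : LinearMap.BilinForm ℝ V) (c : V →ₗ[ℝ] V →ₗ[ℝ] ℂ) (κ : ℝ) (v w : V) :
    twisted h c κ v w = h v w - κ * (c v w).re := by
  simp [twisted]

/-- The set of all `(κ, u, v)` with `κ ∈ [0, 1]` and `u, v` an orthonormal basis of a plane on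
which `h - κ Re c` is nonnegative. -/
def orthonormalFrames (h : LinearMap.BilinForm ℝ V) (c : V →ₗ[ℝ] V →ₗ[ℝ] ℂ) : Set (ℝ × V × V) :=
  {p | p.1 ∈ Set.Icc (0 : ℝ) 1 ∧ ‖p.2.1‖ = 1 ∧ ‖p.2.2‖ = 1 ∧ inner ℝ p.2.1 p.2.2 = 0 ∧
    ∀ x y : ℝ, 0 ≤ twisted h c p.1 (x • p.2.1 + y • p.2.2) (x • p.2.1 + y • p.2.2)}

lemma isNonnegFrame_of_mem {h : LinearMap.BilinForm ℝ V} {c : V →ₗ[ℝ] V →ₗ[ℝ] ℂ}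
    {p : ℝ × V × V} (hp : p ∈ orthonormalFrames h c) :
    IsNonnegFrame (twisted h c p.1) p.2.1 p.2.2 := by
  obtain ⟨-, h1, h2, h3, h4⟩ := hp
  refine ⟨fun x y h0 => ?_, h4⟩
  have hx := congrArg (fun w => inner ℝ p.2.1 w) h0
  have hy := congrArg (fun w => inner ℝ p.2.2 w) h0
  simp only [inner_add_right, real_inner_smul_right, real_inner_self_eq_norm_sq, h1, h2, h3,
    inner_zero_right, real_inner_comm p.2.1 p.2.2] at hx hy
  constructor <;> linarith

lemma exists_mem_orthonormalFrames {h : LinearMap.BilinForm ℝ V} {c : V →ₗ[ℝ] V →ₗ[ℝ] ℂ}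
    (hc : ∀ v w, c v w = c w v) {κ : ℝ} (hκ : κ ∈ Set.Icc (0 : ℝ) 1) {u v : V}
    (hf : IsNonnegFrame (twisted h c κ) u v) :
    ∃ r > 0, ∃ u' v', (κ, u', v') ∈ orthonormalFrames h c ∧
      frameDisc c u' v' = r * frameDisc c u v := by
  obtain ⟨x, y, z, w, hdet, h1, h2, h3⟩ := hf.exists_orthonormal
  exact ⟨(x * w - y * z) ^ 2, by positivity, _, _,
    ⟨hκ, h1, h2, h3, (hf.combination hdet).nonneg⟩, frameDisc_combination hc _ _ _ _ _ _⟩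

variable [FiniteDimensional ℝ V]

lemma isCompact_orthonormalFrames (h : LinearMap.BilinForm ℝ V) (c : V →ₗ[ℝ] V →ₗ[ℝ] ℂ) :
    IsCompact (orthonormalFrames h c) := by
  have hK : IsCompact (Set.Icc (0 : ℝ) 1 ×ˢ (Metric.closedBall (0 : V) 1 ×ˢ
      Metric.closedBall (0 : V) 1)) :=
    isCompact_Icc.prod ((isCompact_closedBall _ _).prod (isCompact_closedBall _ _))
  refine hK.of_isClosed_subset ?_ ?_
  · simp only [orthonormalFrames, twisted_apply, Set.ofPred_and, Set.ofPred_forall]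
    refine (isClosed_Icc.preimage continuous_fst).inter <| IsClosed.inter ?_ <|
      IsClosed.inter ?_ <| IsClosed.inter ?_ <| isClosed_iInter fun x => isClosed_iInter fun y => ?_
    · exact isClosed_eq (by fun_prop) continuous_const
    · exact isClosed_eq (by fun_prop) continuous_const
    · exact isClosed_eq (by fun_prop) continuous_const
    · have hw : Continuous fun p : ℝ × V × V => x • p.2.1 + y • p.2.2 := by fun_prop
      exact isClosed_le continuous_const ((continuous_bilin h hw hw).sub
        (continuous_fst.mul (Complex.continuous_re.comp (continuous_bilin c hw hw))))
  · rintro p ⟨h1, h2, h3, -⟩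
    exact ⟨h1, by simp [h2], by simp [h3]⟩

/-- Let `h` be a Hermitian and `c` a complex symmetric form. If for every `κ ∈ [0, 1)` the real form
`h - κ Re c` is nonnegative on some real plane, then `|c| ≤ h` somewhere outside the origin.
Otherwise `c` has no zero on a nonnegative plane. Complex lines are nonnegative planes for `κ = 0`
on which `frameDisc c` is negative, while it is positive on all nonnegative planes for `κ = 1`;
by connectedness both signs occur for a common `κ`, which is impossible. -/
theorem exists_norm_le {h : LinearMap.BilinForm ℝ V} (hh : ∀ v w, h v w = h w v)
    {c : V →ₗ[ℝ] V →ₗ[ℝ] ℂ} (hc : ∀ v w, c v w = c w v) {J : V → V}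
    (hJh : ∀ v, h (J v) (J v) = h v v) (hJ0 : ∀ v, h v (J v) = 0)
    (hJc : ∀ v w, c (J v) w = Complex.I * c v w)
    (hpl : ∀ κ ∈ Set.Ico (0 : ℝ) 1, ∃ u v, IsNonnegFrame (twisted h c κ) u v) :
    ∃ d ≠ 0, ‖c d d‖ ≤ h d d := by
  by_contra! hlt
  have htw : ∀ κ v w, twisted h c κ v w = twisted h c κ w v := fun κ v w => by
    rw [twisted_apply, twisted_apply, hh, hc]
  have hdef : ∀ κ w, 0 ≤ twisted h c κ w w → c w w = 0 → w = 0 := by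
    intro κ w h1 h2
    rw [twisted_apply, h2] at h1
    by_contra h0
    have := hlt w h0
    rw [h2] at this
    simp at this h1
    linarith
  have hcpt := isCompact_orthonormalFrames h c
  have hD : Continuous fun p : ℝ × V × V => frameDisc c p.2.1 p.2.2 :=
    continuous_frameDisc c (by fun_prop) (by fun_prop)
  -- The parameters for which `frameDisc` takes each of the two signs.
  set Kp : Set ℝ := Prod.fst '' (orthonormalFrames h c ∩ {p | 0 ≤ frameDisc c p.2.1 p.2.2})
    with hKp
  set Kn : Set ℝ := Prod.fst '' (orthonormalFrames h c ∩ {p | frameDisc c p.2.1 p.2.2 ≤ 0})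
    with hKn
  have hKpc : IsClosed Kp :=
    ((hcpt.inter_right (isClosed_le continuous_const hD)).image continuous_fst).isClosed
  have hKnc : IsClosed Kn :=
    ((hcpt.inter_right (isClosed_le hD continuous_const)).image continuous_fst).isClosed
  have hcover : Set.Icc (0 : ℝ) 1 ⊆ Kp ∪ Kn := by
    rw [← closure_Ico (zero_ne_one' ℝ)]
    refine closure_minimal (fun κ hκ => ?_) (hKpc.union hKnc)
    obtain ⟨u, v, hf⟩ := hpl κ hκ
    obtain ⟨r, -, u', v', hm, -⟩ := exists_mem_orthonormalFrames hc (Set.Ico_subset_Icc_self hκ) hf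
    rcases le_total 0 (frameDisc c u' v') with h1 | h1
    · exact Or.inl ⟨_, ⟨hm, h1⟩, rfl⟩
    · exact Or.inr ⟨_, ⟨hm, h1⟩, rfl⟩
  have hone : (1 : ℝ) ∈ Kp := by
    -- If `c w` is real and `Re (c w) ≤ h w < |c w|`, then `c w` is negative.
    have key : ∀ p ∈ orthonormalFrames h c, p.1 = 1 → 0 < frameDisc c p.2.1 p.2.2 := by
      intro p hp hp1
      have hf := isNonnegFrame_of_mem hp
      refine pencilDisc_pos fun x y hxy him => ?_
      rw [← apply_combination_self hc] at him ⊢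
      set w := x • p.2.1 + y • p.2.2 with hw
      have hw0 : w ≠ 0 := by
        intro h0
        obtain ⟨h1, h2⟩ := hf.indep x y h0
        rcases hxy with h3 | h3
        · exact h3 h1
        · exact h3 h2
      have h1 := hf.nonneg x y
      rw [← hw, hp1, twisted_apply, one_mul] at h1
      have h2 := hlt w hw0
      have h3 : ‖c w w‖ = |(c w w).re| := by
        conv_lhs => rw [← Complex.re_add_im (c w w), him]
        simp
      by_contra! h4
      rw [h3, abs_of_nonneg h4] at h2
      linarith
    rcases hcover (Set.right_mem_Icc.2 zero_le_one) with h1 | ⟨p, ⟨hp, -⟩, hp1⟩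
    · exact h1
    · exact ⟨p, ⟨hp, (key p hp hp1).le⟩, hp1⟩
  have hzero : (0 : ℝ) ∈ Kn := by
    -- `h` is nonnegative on the complex line spanned by a vector where it is nonnegative.
    obtain ⟨u, v, hf⟩ := hpl 0 ⟨le_rfl, zero_lt_one⟩
    have hu0 : u ≠ 0 := by
      rintro rfl
      have := (hf.indep 1 0 (by simp)).1
      norm_num at this
    have hu : 0 ≤ h u u := by
      have := hf.nonneg 1 0
      simpa [twisted_apply] using this
    have hcu : c u u ≠ 0 := by
      intro h0
      have := hlt u hu0
      rw [h0, norm_zero] at this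
      linarith
    have hcJ : c u (J u) = Complex.I * c u u := by rw [hc, hJc]
    have hcJJ : c (J u) (J u) = -c u u := by
      rw [hJc, hcJ, ← mul_assoc, Complex.I_mul_I]; ring
    have hfJ : IsNonnegFrame (twisted h c 0) u (J u) := by
      refine ⟨fun x y h0 => ?_, fun x y => ?_⟩
      · have h1 := congrArg (fun w => c w u) h0
        simp only [map_add, map_smul, LinearMap.add_apply, LinearMap.smul_apply, hJc, map_zero,
          LinearMap.zero_apply, Complex.real_smul] at h1
        have h2 : ((x : ℂ) + y * Complex.I) * c u u = 0 := by rw [← h1]; ring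
        have h3 := (mul_eq_zero.1 h2).resolve_right hcu
        have hre := congrArg Complex.re h3
        have him := congrArg Complex.im h3
        simp at hre him
        exact ⟨hre, him⟩
      · rw [twisted_apply]
        simp only [map_add, map_smul, LinearMap.add_apply, LinearMap.smul_apply, smul_eq_mul,
          hJ0, hh (J u) u, hJh]
        nlinarith [mul_nonneg (sq_nonneg x) hu, mul_nonneg (sq_nonneg y) hu]
    obtain ⟨r, hr, u', v', hm, hd⟩ :=
      exists_mem_orthonormalFrames hc (Set.left_mem_Icc.2 zero_le_one) hfJ
    refine ⟨_, ⟨hm, ?_⟩, rfl⟩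
    have hneg : frameDisc c u (J u) ≤ 0 := by
      rw [frameDisc, pencilDisc, hcJ, hcJJ]
      have h1 : c u u * -c u u - (Complex.I * c u u) ^ 2 = 0 := by
        rw [mul_pow, Complex.I_sq]; ring
      rw [h1, norm_zero, map_neg, mul_neg, Complex.mul_conj, norm_mul, Complex.norm_I, one_mul,
        Complex.neg_re, Complex.ofReal_re, Complex.normSq_eq_norm_sq]
      nlinarith [sq_nonneg ‖c u u‖]
    change frameDisc c u' v' ≤ 0
    rw [hd]
    exact mul_nonpos_of_nonneg_of_nonpos hr.le hneg
  obtain ⟨κ, -, ⟨p, ⟨hp, hp1⟩, rfl⟩, p', ⟨hp', hp1'⟩, hpp⟩ :=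
    isPreconnected_closed_iff.1 (isPreconnected_Icc (a := (0 : ℝ)) (b := 1)) Kp Kn hKpc hKnc hcover
      ⟨1, Set.right_mem_Icc.2 zero_le_one, hone⟩ ⟨0, Set.left_mem_Icc.2 zero_le_one, hzero⟩
  have hf := isNonnegFrame_of_mem hp
  have hf' := isNonnegFrame_of_mem hp'
  rw [hpp] at hf'
  have h1 := lt_of_le_of_ne hp1 (frameDisc_ne_zero hc (hdef _) hf).symm
  exact absurd ((frameDisc_pos_iff (htw _) hc (hdef _) hf hf').1 h1) (not_lt.2 hp1')

end Pencil

/-! ### Generalized singular values -/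

section GSVD

variable {a b w : Type*} [Fintype a] [Fintype b] [Fintype w] [DecidableEq w]

open scoped MatrixOrder Matrix.Norms.L2Operator in
lemma exists_isUnit_congr_one {S : Matrix w w ℝ} (hS : S.PosDef) :
    ∃ T : Matrix w w ℝ, IsUnit T ∧ Tᵀ * S * T = 1 := by
  obtain ⟨y, hy, rfl⟩ := CStarAlgebra.isStrictlyPositive_iff_eq_star_mul_self.mp
    hS.isStrictlyPositive
  have hd : IsUnit y.det := (Matrix.isUnit_iff_isUnit_det y).1 hy
  refine ⟨y⁻¹, (Matrix.isUnit_nonsing_inv_iff).2 hy, ?_⟩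
  have h1 : star y = yᵀ := by rw [star_eq_conjTranspose, conjTranspose_eq_transpose_of_trivial]
  rw [h1, ← Matrix.mul_assoc, ← transpose_mul, Matrix.mul_nonsing_inv y hd, transpose_one,
    Matrix.one_mul, Matrix.mul_nonsing_inv y hd]

/-- A pair without a common null vector has a generalized singular value decomposition: reduce
`AᵀA + BᵀB` to the identity, then diagonalize `AᵀA` orthogonally. -/
lemma exists_isGSVD (A : Matrix a w ℝ) (B : Matrix b w ℝ)
    (hker : ∀ x, A *ᵥ x = 0 → B *ᵥ x = 0 → x = 0) : ∃ X α β, IsGSVD A B X α β := by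
  have hS : (Aᵀ * A + Bᵀ * B).PosDef := by
    have hA := Matrix.posSemidef_conjTranspose_mul_self A
    have hB := Matrix.posSemidef_conjTranspose_mul_self B
    rw [conjTranspose_eq_transpose_of_trivial] at hA hB
    refine .of_dotProduct_mulVec_pos (hA.add hB).1 fun x hx => ?_
    have key : star x ⬝ᵥ ((Aᵀ * A + Bᵀ * B) *ᵥ x) =
        (A *ᵥ x) ⬝ᵥ (A *ᵥ x) + (B *ᵥ x) ⬝ᵥ (B *ᵥ x) := by
      rw [add_mulVec, dotProduct_add, ← mulVec_mulVec, ← mulVec_mulVec, star_trivial,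
        dotProduct_mulVec, dotProduct_mulVec x, vecMul_transpose, vecMul_transpose]
    have h1 : 0 ≤ (A *ᵥ x) ⬝ᵥ (A *ᵥ x) := Finset.sum_nonneg fun i _ => mul_self_nonneg _
    have h2 : 0 ≤ (B *ᵥ x) ⬝ᵥ (B *ᵥ x) := Finset.sum_nonneg fun i _ => mul_self_nonneg _
    rw [key]
    refine lt_of_le_of_ne (add_nonneg h1 h2) fun h0 => hx (hker x ?_ ?_)
    · exact dotProduct_self_eq_zero.1 (by linarith)
    · exact dotProduct_self_eq_zero.1 (by linarith)
  obtain ⟨T, hT, hTS⟩ := exists_isUnit_congr_one hS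
  have hGpsd : ((A * T)ᵀ * (A * T)).PosSemidef := by
    have := Matrix.posSemidef_conjTranspose_mul_self (A * T)
    rwa [conjTranspose_eq_transpose_of_trivial] at this
  set U : Matrix w w ℝ := hGpsd.1.eigenvectorUnitary.1 with hU
  have hUU : Uᵀ * U = 1 := by
    have := Unitary.coe_star_mul_self hGpsd.1.eigenvectorUnitary
    rwa [star_eq_conjTranspose, conjTranspose_eq_transpose_of_trivial] at this
  have hUu : IsUnit U := IsUnit.of_mul_eq_one_right _ hUU
  have hdiag : Uᵀ * ((A * T)ᵀ * (A * T)) * U = diagonal hGpsd.1.eigenvalues := by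
    have := hGpsd.1.conjStarAlgAut_star_eigenvectorUnitary
    rw [Unitary.conjStarAlgAut_star_apply, star_eq_conjTranspose,
      conjTranspose_eq_transpose_of_trivial] at this
    exact this
  have hA' : (A * (T * U))ᵀ * (A * (T * U)) = diagonal hGpsd.1.eigenvalues := by
    rw [← hdiag]; simp only [transpose_mul, Matrix.mul_assoc]
  have hsum : (A * (T * U))ᵀ * (A * (T * U)) + (B * (T * U))ᵀ * (B * (T * U)) = 1 := by
    have : (A * (T * U))ᵀ * (A * (T * U)) + (B * (T * U))ᵀ * (B * (T * U)) =
        Uᵀ * (Tᵀ * (Aᵀ * A + Bᵀ * B) * T) * U := by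
      simp only [transpose_mul, Matrix.mul_assoc, Matrix.mul_add, Matrix.add_mul]
    rw [this, hTS, Matrix.mul_one, hUU]
  have hB' : (B * (T * U))ᵀ * (B * (T * U)) = diagonal (fun j => 1 - hGpsd.1.eigenvalues j) := by
    rw [← eq_sub_iff_add_eq', hA'] at hsum
    rw [hsum, ← diagonal_one, diagonal_sub]
  have hle : ∀ j, 0 ≤ 1 - hGpsd.1.eigenvalues j := by
    intro j
    have h1 : ((B * (T * U))ᵀ * (B * (T * U))) j j = 1 - hGpsd.1.eigenvalues j := by
      rw [hB', diagonal_apply_eq]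
    rw [← h1, Matrix.mul_apply]
    exact Finset.sum_nonneg fun i _ => mul_self_nonneg _
  refine ⟨T * U, fun j => √(hGpsd.1.eigenvalues j), fun j => √(1 - hGpsd.1.eigenvalues j),
    hT.mul hUu, fun j => Real.sqrt_nonneg _, fun j => Real.sqrt_nonneg _, ?_, ?_⟩
  · rw [hA']
    congr 1
    ext j
    rw [Real.sq_sqrt (hGpsd.eigenvalues_nonneg j)]
  · rw [hB']
    congr 1
    ext j
    rw [Real.sq_sqrt (hle j)]

lemma dotProduct_mulVec_self_of_gram {A : Matrix a w ℝ} {X : Matrix w w ℝ} {α : w → ℝ}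
    (h : (A * X)ᵀ * (A * X) = diagonal fun j => α j ^ 2) (y : w → ℝ) :
    (A *ᵥ (X *ᵥ y)) ⬝ᵥ (A *ᵥ (X *ᵥ y)) = ∑ j, α j ^ 2 * y j ^ 2 := by
  have h1 : (A *ᵥ (X *ᵥ y)) ⬝ᵥ (A *ᵥ (X *ᵥ y)) = y ⬝ᵥ (((A * X)ᵀ * (A * X)) *ᵥ y) := by
    rw [← mulVec_mulVec, dotProduct_mulVec y, vecMul_transpose, mulVec_mulVec]
  rw [h1, h, dotProduct]
  refine Finset.sum_congr rfl fun j _ => ?_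
  rw [mulVec_diagonal]; ring

lemma div_le_ofReal_iff {ρ x y : ℝ} (hρ : 0 ≤ ρ) (hy : 0 ≤ y) :
    ENNReal.ofReal x / ENNReal.ofReal y ≤ ENNReal.ofReal ρ ↔ x ≤ ρ * y := by
  rw [ENNReal.div_le_iff_le_mul (Or.inr ENNReal.ofReal_ne_top) (Or.inl ENNReal.ofReal_ne_top),
    ← ENNReal.ofReal_mul hρ, ENNReal.ofReal_le_ofReal_iff (mul_nonneg hρ hy)]

/-- A plane on which `|A x| ≤ ρ |B x|` meets every hyperplane, so all generalized singular values
but the largest are at most `ρ`. -/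
lemma gsv_le {A : Matrix a w ℝ} {B : Matrix b w ℝ} {ρ : ℝ} (hρ : 0 ≤ ρ) {x₁ x₂ : w → ℝ}
    (hind : ∀ r s : ℝ, r • x₁ + s • x₂ = 0 → r = 0 ∧ s = 0)
    (hle : ∀ r s : ℝ, (A *ᵥ (r • x₁ + s • x₂)) ⬝ᵥ (A *ᵥ (r • x₁ + s • x₂)) ≤
      ρ ^ 2 * ((B *ᵥ (r • x₁ + s • x₂)) ⬝ᵥ (B *ᵥ (r • x₁ + s • x₂))))
    {i : ℕ} (hi : Fintype.card w ≤ i + 1) : gsv i A B ≤ ENNReal.ofReal ρ := by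
  refine sSup_le ?_
  rintro τ ⟨X, α, β, hX, hcard⟩
  by_contra! hτ
  set S : Set w := {j | τ ≤ ENNReal.ofReal (α j) / ENNReal.ofReal (β j)} with hSdef
  have hS : ∀ j ∈ S, ρ * β j < α j := by
    intro j hj
    by_contra! hle
    exact absurd (hτ.trans_le (hj.trans
      ((div_le_ofReal_iff hρ (hX.right_nonneg j)).2 hle))) (lt_irrefl _)
  have hcompl : Sᶜ.ncard ≤ 1 := by
    have := Set.ncard_add_ncard_compl S
    rw [Nat.card_eq_fintype_card] at this
    omega
  rw [Set.ncard_le_one_iff] at hcompl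
  obtain ⟨y₁, hy₁⟩ : ∃ y, X *ᵥ y = x₁ := (mulVec_surjective_iff_isUnit.2 hX.isUnit) x₁
  obtain ⟨y₂, hy₂⟩ : ∃ y, X *ᵥ y = x₂ := (mulVec_surjective_iff_isUnit.2 hX.isUnit) x₂
  -- A nonzero vector of the plane whose coordinates outside `S` vanish.
  obtain ⟨r, s, hrs, hvan⟩ : ∃ r s : ℝ, (r ≠ 0 ∨ s ≠ 0) ∧ ∀ j ∉ S, r * y₁ j + s * y₂ j = 0 := by
    by_cases hne : ∃ j₀, j₀ ∉ S ∧ (y₂ j₀ ≠ 0 ∨ y₁ j₀ ≠ 0)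
    · obtain ⟨j₀, hj₀, hy⟩ := hne
      refine ⟨y₂ j₀, -y₁ j₀, by simpa using hy, fun j hj => ?_⟩
      rw [hcompl (a := j) (b := j₀) hj hj₀]; ring
    · push Not at hne
      refine ⟨1, 0, by simp, fun j hj => ?_⟩
      simp [(hne j hj).2]
  set y : w → ℝ := r • y₁ + s • y₂ with hy
  have hXy : X *ᵥ y = r • x₁ + s • x₂ := by
    rw [hy, mulVec_add, mulVec_smul, mulVec_smul, hy₁, hy₂]
  have hy0 : y ≠ 0 := by
    intro h0
    rw [h0, mulVec_zero] at hXy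
    obtain ⟨h1, h2⟩ := hind r s hXy.symm
    rcases hrs with h | h
    · exact h h1
    · exact h h2
  have hmain := hle r s
  rw [← hXy, dotProduct_mulVec_self_of_gram hX.left_gram,
    dotProduct_mulVec_self_of_gram hX.right_gram, Finset.mul_sum] at hmain
  obtain ⟨j₁, hj₁⟩ := Function.ne_iff.1 hy0
  have hterm : ∀ j, ρ ^ 2 * (β j ^ 2 * y j ^ 2) ≤ α j ^ 2 * y j ^ 2 := by
    intro j
    by_cases hj : j ∈ S
    · have h1 := mul_nonneg hρ (hX.right_nonneg j)
      have h2 : (ρ * β j) ^ 2 ≤ α j ^ 2 := pow_le_pow_left₀ h1 (hS j hj).le 2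
      nlinarith [mul_le_mul_of_nonneg_right h2 (sq_nonneg (y j))]
    · have : y j = 0 := hvan j hj
      simp [this]
  refine absurd hmain (not_le.2 (Finset.sum_lt_sum (fun j _ => hterm j) ⟨j₁, Finset.mem_univ _, ?_⟩))
  have hj₁S : j₁ ∈ S := by
    by_contra hj
    exact hj₁ (hvan j₁ hj)
  have h1 := mul_nonneg hρ (hX.right_nonneg j₁)
  have h2 : (ρ * β j₁) ^ 2 < α j₁ ^ 2 := pow_lt_pow_left₀ (hS j₁ hj₁S) h1 two_ne_zero
  have h3 : 0 < y j₁ ^ 2 := by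
    have : y j₁ ≠ 0 := hj₁
    positivity
  nlinarith [mul_lt_mul_of_pos_right h2 h3]

/-- If the second smallest generalized singular value is at most `ρ`, then `|A x| ≤ ρ |B x|` on some
plane. -/
lemma exists_plane_of_gsv_le {A : Matrix a w ℝ} {B : Matrix b w ℝ} {ρ : ℝ} (hρ : 0 ≤ ρ)
    (hker : ∀ x, A *ᵥ x = 0 → B *ᵥ x = 0 → x = 0) {i : ℕ} (hi : Fintype.card w = i + 1)
    (hi0 : 0 < i) (hgsv : gsv i A B ≤ ENNReal.ofReal ρ) :
    ∃ x₁ x₂ : w → ℝ, (∀ r s : ℝ, r • x₁ + s • x₂ = 0 → r = 0 ∧ s = 0) ∧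
      ∀ r s : ℝ, (A *ᵥ (r • x₁ + s • x₂)) ⬝ᵥ (A *ᵥ (r • x₁ + s • x₂)) ≤
        ρ ^ 2 * ((B *ᵥ (r • x₁ + s • x₂)) ⬝ᵥ (B *ᵥ (r • x₁ + s • x₂))) := by
  obtain ⟨X, α, β, hX⟩ := exists_isGSVD A B hker
  set S : Set w := {j | ENNReal.ofReal ρ < ENNReal.ofReal (α j) / ENNReal.ofReal (β j)} with hS
  have hcompl : 1 < Sᶜ.ncard := by
    by_contra! hc
    have h1 := Set.ncard_add_ncard_compl S
    rw [Nat.card_eq_fintype_card] at h1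
    have hiS : i ≤ S.ncard := by omega
    have hne : S.Nonempty := by
      rw [← Set.ncard_pos]; omega
    obtain ⟨j₀, hj₀, hmin⟩ := Set.exists_min_image S
      (fun j => ENNReal.ofReal (α j) / ENNReal.ofReal (β j)) S.toFinite hne
    refine absurd (hj₀.trans_le (le_trans (le_sSup ?_) hgsv)) (lt_irrefl _)
    exact ⟨X, α, β, hX, hiS.trans (Set.ncard_le_ncard hmin (Set.toFinite _))⟩
  rw [Set.one_lt_ncard] at hcompl
  obtain ⟨j₁, hj₁, j₂, hj₂, hj⟩ := hcompl
  have hle : ∀ j ∈ Sᶜ, α j ^ 2 ≤ ρ ^ 2 * β j ^ 2 := by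
    intro j hj
    have h1 : α j ≤ ρ * β j :=
      (div_le_ofReal_iff hρ (hX.right_nonneg j)).1 (not_lt.1 hj)
    rw [← mul_pow]
    exact pow_le_pow_left₀ (hX.left_nonneg j) h1 2
  have hcomb : ∀ r s : ℝ, r • (X *ᵥ Pi.single j₁ 1) + s • (X *ᵥ Pi.single j₂ 1) =
      X *ᵥ (r • Pi.single j₁ 1 + s • Pi.single j₂ 1) := by
    intro r s
    rw [mulVec_add, mulVec_smul, mulVec_smul]
  refine ⟨X *ᵥ Pi.single j₁ 1, X *ᵥ Pi.single j₂ 1, fun r s h0 => ?_, fun r s => ?_⟩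
  · rw [hcomb] at h0
    have h1 := mulVec_injective_iff_isUnit.2 hX.isUnit (h0.trans (mulVec_zero X).symm)
    have h2 := congrFun h1 j₁
    have h3 := congrFun h1 j₂
    simp [hj, hj.symm] at h2 h3
    exact ⟨h2, h3⟩
  · rw [hcomb, dotProduct_mulVec_self_of_gram hX.left_gram,
      dotProduct_mulVec_self_of_gram hX.right_gram, Finset.mul_sum]
    refine Finset.sum_le_sum fun j _ => ?_
    by_cases hjS : j ∈ Sᶜ
    · nlinarith [mul_le_mul_of_nonneg_right (hle j hjS)
        (sq_nonneg ((r • Pi.single j₁ 1 + s • Pi.single j₂ 1 : w → ℝ) j))]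
    · have h1 : j ≠ j₁ := fun h => hjS (h ▸ hj₁)
      have h2 : j ≠ j₂ := fun h => hjS (h ▸ hj₂)
      simp [h1, h2]

end GSVD

/-! ### Real matrices of bounded norm with prescribed values -/

section SpectralNorm

variable {a b : Type*} [Fintype a] [DecidableEq a] [Fintype b] [DecidableEq b]

lemma dotProduct_mulVec_self_le (Δ : Matrix a b ℝ) (v : b → ℝ) :
    (Δ *ᵥ v) ⬝ᵥ (Δ *ᵥ v) ≤ spectralNorm Δ ^ 2 * (v ⬝ᵥ v) := by
  have h := (Matrix.toEuclideanLin Δ).toContinuousLinearMap.le_opNorm (WithLp.toLp 2 v)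
  have h2 := pow_le_pow_left₀ (norm_nonneg _) h 2
  rw [mul_pow, EuclideanSpace.real_norm_sq_eq, EuclideanSpace.real_norm_sq_eq] at h2
  simp only [dotProduct, spectralNorm, ← pow_two]
  exact h2

lemma spectralNorm_nonneg (Δ : Matrix a b ℝ) : 0 ≤ spectralNorm Δ := norm_nonneg _

/-- A real linear map of norm at most `ρ` taking two given vectors to two given vectors exists as
soon as the required norm inequality holds on the span of the former: extend by zero on the
orthogonal complement. -/
lemma exists_spectralNorm_le {ρ : ℝ} (hρ : 0 ≤ ρ) (u₁ u₂ : b → ℝ) (v₁ v₂ : a → ℝ)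
    (h : ∀ x y : ℝ, (x • v₁ + y • v₂) ⬝ᵥ (x • v₁ + y • v₂) ≤
      ρ ^ 2 * ((x • u₁ + y • u₂) ⬝ᵥ (x • u₁ + y • u₂))) :
    ∃ Δ : Matrix a b ℝ, spectralNorm Δ ≤ ρ ∧ Δ *ᵥ u₁ = v₁ ∧ Δ *ᵥ u₂ = v₂ := by
  let T : (ℝ × ℝ) →ₗ[ℝ] EuclideanSpace ℝ b :=
    (LinearMap.fst ℝ ℝ ℝ).smulRight (WithLp.toLp 2 u₁) +
      (LinearMap.snd ℝ ℝ ℝ).smulRight (WithLp.toLp 2 u₂)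
  let S : (ℝ × ℝ) →ₗ[ℝ] EuclideanSpace ℝ a :=
    (LinearMap.fst ℝ ℝ ℝ).smulRight (WithLp.toLp 2 v₁) +
      (LinearMap.snd ℝ ℝ ℝ).smulRight (WithLp.toLp 2 v₂)
  have hST : ∀ p, ‖S p‖ ≤ ρ * ‖T p‖ := by
    intro p
    refine (sq_le_sq₀ (norm_nonneg _) (mul_nonneg hρ (norm_nonneg _))).1 ?_
    rw [mul_pow, EuclideanSpace.real_norm_sq_eq, EuclideanSpace.real_norm_sq_eq]
    have := h p.1 p.2
    simp only [dotProduct, ← pow_two] at this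
    exact this
  obtain ⟨g, hg⟩ := T.rangeRestrict.exists_rightInverse_of_surjective T.range_rangeRestrict
  have hTg : ∀ y, T (g y) = y := fun y => congrArg Subtype.val (LinearMap.congr_fun hg y)
  let L : EuclideanSpace ℝ b →ₗ[ℝ] EuclideanSpace ℝ a :=
    S ∘ₗ g ∘ₗ (LinearMap.range T).orthogonalProjectionOnto.toLinearMap
  have hL : ∀ p, L (T p) = S p := by
    intro p
    have h1 : (LinearMap.range T).orthogonalProjectionOnto (T p) = ⟨T p, LinearMap.mem_range_self T p⟩ :=
      Submodule.orthogonalProjectionOnto_mem_subspace_eq_self (K := LinearMap.range T)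
        ⟨T p, LinearMap.mem_range_self T p⟩
    have h2 : L (T p) = S (g ⟨T p, LinearMap.mem_range_self T p⟩) := by
      rw [← h1]; rfl
    rw [h2, ← sub_eq_zero, ← map_sub, ← norm_le_zero_iff]
    refine (hST _).trans ?_
    rw [map_sub, hTg, sub_self, norm_zero, mul_zero]
  have hLn : ∀ x, ‖L x‖ ≤ ρ * ‖x‖ := by
    intro x
    refine (hST _).trans (mul_le_mul_of_nonneg_left ?_ hρ)
    refine (congrArg norm (hTg _)).le.trans ?_
    exact Submodule.norm_orthogonalProjectionOnto_apply_le _ x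
  refine ⟨Matrix.toEuclideanLin.symm L, ?_, ?_, ?_⟩
  · rw [spectralNorm, LinearEquiv.apply_symm_apply]
    exact ContinuousLinearMap.opNorm_le_bound _ hρ hLn
  · have h1 := hL (1, 0)
    have h2 : T (1, 0) = WithLp.toLp 2 u₁ := by simp [T]
    have h3 : S (1, 0) = WithLp.toLp 2 v₁ := by simp [S]
    rw [h2, h3, ← LinearEquiv.apply_symm_apply Matrix.toEuclideanLin L] at h1
    exact congrArg WithLp.ofLp h1
  · have h1 := hL (0, 1)
    have h2 : T (0, 1) = WithLp.toLp 2 u₂ := by simp [T]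
    have h3 : S (0, 1) = WithLp.toLp 2 v₂ := by simp [S]
    rw [h2, h3, ← LinearEquiv.apply_symm_apply Matrix.toEuclideanLin L] at h1
    exact congrArg WithLp.ofLp h1

end SpectralNorm

/-! ### The real block matrices as real quadratic forms -/

section RealBlock

variable {q r ι : Type*}

/-- The vector `a + iγb`, for `x = (a, b)`. -/
def complexify (γ : ℝ) (x : ι ⊕ ι → ℝ) : ι → ℂ := fun i => ⟨x (Sum.inl i), γ * x (Sum.inr i)⟩

lemma complexify_combination (γ : ℝ) (x₁ x₂ : ι ⊕ ι → ℝ) (a b : ℝ) :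
    complexify γ (a • x₁ + b • x₂) = (a : ℂ) • complexify γ x₁ + (b : ℂ) • complexify γ x₂ := by
  ext i
  apply Complex.ext <;> simp [complexify]
  ring

lemma complexify_eq_zero {γ : ℝ} (hγ : γ ≠ 0) {x : ι ⊕ ι → ℝ} (h : complexify γ x = 0) :
    x = 0 := by
  ext i
  rcases i with i | i
  · exact congrArg Complex.re (congrFun h i)
  · have := congrArg Complex.im (congrFun h i)
    simpa [complexify, hγ] using this

lemma exists_complexify_eq {γ : ℝ} (hγ : γ ≠ 0) (z : ι → ℂ) : ∃ x, complexify γ x = z := by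
  refine ⟨Sum.elim (fun i => (z i).re) (fun i => γ⁻¹ * (z i).im), ?_⟩
  ext i
  apply Complex.ext <;> simp [complexify, hγ]

variable [Fintype q] [Fintype r] [Fintype ι]

lemma realBlock_mulVec_self {γ : ℝ} (hγ : γ ≠ 0) (M : Matrix q ι ℂ) (x : ι ⊕ ι → ℝ) :
    (realBlock γ M *ᵥ x) ⬝ᵥ (realBlock γ M *ᵥ x) =
      ∑ i, (((M *ᵥ complexify γ x) i).re ^ 2 + (γ ^ 2)⁻¹ * ((M *ᵥ complexify γ x) i).im ^ 2) := by
  have h1 : ∀ i, (realBlock γ M *ᵥ x) (Sum.inl i) = ((M *ᵥ complexify γ x) i).re := by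
    intro i
    simp only [realBlock, mulVec, dotProduct, Fintype.sum_sum_type, fromBlocks_apply₁₁,
      fromBlocks_apply₁₂, Complex.re_sum, complexify, Complex.mul_re, map_apply, Matrix.neg_apply,
      Matrix.smul_apply, smul_eq_mul]
    rw [← Finset.sum_add_distrib]
    exact Finset.sum_congr rfl fun j _ => by ring
  have h2 : ∀ i, (realBlock γ M *ᵥ x) (Sum.inr i) = γ⁻¹ * ((M *ᵥ complexify γ x) i).im := by
    intro i
    simp only [realBlock, mulVec, dotProduct, Fintype.sum_sum_type, fromBlocks_apply₂₁,
      fromBlocks_apply₂₂, Complex.im_sum, complexify, Complex.mul_im, map_apply,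
      Matrix.smul_apply, smul_eq_mul]
    rw [← Finset.sum_add_distrib, Finset.mul_sum]
    refine Finset.sum_congr rfl fun j _ => ?_
    field_simp
    ring
  rw [dotProduct, Fintype.sum_sum_type, ← Finset.sum_add_distrib]
  refine Finset.sum_congr rfl fun i _ => ?_
  rw [h1, h2]
  field_simp

lemma mulVec_complexify_eq_zero {γ : ℝ} (hγ : γ ≠ 0) {M : Matrix q ι ℂ} {x : ι ⊕ ι → ℝ}
    (h : realBlock γ M *ᵥ x = 0) : M *ᵥ complexify γ x = 0 := by
  have h1 := realBlock_mulVec_self hγ M x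
  rw [h, dotProduct_zero] at h1
  have hγ2 : 0 < (γ ^ 2)⁻¹ := by positivity
  have h2 := (Finset.sum_eq_zero_iff_of_nonneg (fun i _ => by positivity)).1 h1.symm
  ext i
  have h3 := h2 i (Finset.mem_univ i)
  have h4 : ((M *ᵥ complexify γ x) i).re ^ 2 = 0 := by
    nlinarith [sq_nonneg ((M *ᵥ complexify γ x) i).re,
      mul_nonneg hγ2.le (sq_nonneg ((M *ᵥ complexify γ x) i).im)]
  have h5 : ((M *ᵥ complexify γ x) i).im ^ 2 = 0 := by
    rw [h4, zero_add] at h3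
    exact (mul_eq_zero.1 h3).resolve_left hγ2.ne'
  exact Complex.ext (by simpa using h4) (by simpa using h5)

/-- The complex symmetric form `ρ² (N v)ᵀ(N w) - (M v)ᵀ(M w)`. -/
def symForm (ρ : ℝ) (M : Matrix q ι ℂ) (N : Matrix r ι ℂ) :
    EuclideanSpace ℂ ι →ₗ[ℝ] EuclideanSpace ℂ ι →ₗ[ℝ] ℂ :=
  LinearMap.mk₂ ℝ (fun v w => (ρ : ℂ) ^ 2 * ((N *ᵥ v) ⬝ᵥ (N *ᵥ w)) - (M *ᵥ v) ⬝ᵥ (M *ᵥ w))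
    (fun v v' w => by
      simp only [WithLp.ofLp_add, mulVec_add, add_dotProduct]; ring)
    (fun a v w => by
      simp only [WithLp.ofLp_smul, mulVec_smul, smul_dotProduct, Complex.real_smul]; ring)
    (fun v w w' => by
      simp only [WithLp.ofLp_add, mulVec_add, dotProduct_add]; ring)
    (fun a v w => by
      simp only [WithLp.ofLp_smul, mulVec_smul, dotProduct_smul, Complex.real_smul]; ring)

/-- The real part of the Hermitian form `ρ² (N v)ᴴ(N w) - (M v)ᴴ(M w)`. -/
def hermForm (ρ : ℝ) (M : Matrix q ι ℂ) (N : Matrix r ι ℂ) :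
    LinearMap.BilinForm ℝ (EuclideanSpace ℂ ι) :=
  LinearMap.mk₂ ℝ
    (fun v w => ρ ^ 2 * (star (N *ᵥ v) ⬝ᵥ (N *ᵥ w)).re - (star (M *ᵥ v) ⬝ᵥ (M *ᵥ w)).re)
    (fun v v' w => by
      simp only [WithLp.ofLp_add, mulVec_add, star_add, add_dotProduct, Complex.add_re]; ring)
    (fun a v w => by
      simp only [WithLp.ofLp_smul, mulVec_smul, star_smul, smul_dotProduct, star_trivial,
        Complex.smul_re, smul_eq_mul]; ring)
    (fun v w w' => by
      simp only [WithLp.ofLp_add, mulVec_add, dotProduct_add, Complex.add_re]; ring)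
    (fun a v w => by
      simp only [WithLp.ofLp_smul, mulVec_smul, dotProduct_smul, Complex.smul_re,
        smul_eq_mul]; ring)

lemma symForm_apply (ρ : ℝ) (M : Matrix q ι ℂ) (N : Matrix r ι ℂ) (v w : EuclideanSpace ℂ ι) :
    symForm ρ M N v w = (ρ : ℂ) ^ 2 * ((N *ᵥ v) ⬝ᵥ (N *ᵥ w)) - (M *ᵥ v) ⬝ᵥ (M *ᵥ w) := rfl

lemma hermForm_apply (ρ : ℝ) (M : Matrix q ι ℂ) (N : Matrix r ι ℂ) (v w : EuclideanSpace ℂ ι) :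
    hermForm ρ M N v w =
      ρ ^ 2 * (star (N *ᵥ v) ⬝ᵥ (N *ᵥ w)).re - (star (M *ᵥ v) ⬝ᵥ (M *ᵥ w)).re := rfl

lemma re_star_dotProduct {l : Type*} [Fintype l] (u v : l → ℂ) :
    (star u ⬝ᵥ v).re = ∑ i, ((u i).re * (v i).re + (u i).im * (v i).im) := by
  simp [dotProduct]

lemma re_dotProduct {l : Type*} [Fintype l] (u v : l → ℂ) :
    (u ⬝ᵥ v).re = ∑ i, ((u i).re * (v i).re - (u i).im * (v i).im) := by
  simp [dotProduct]

lemma sum_twisted_eq {l : Type*} [Fintype l] (κ : ℝ) (u : l → ℂ) :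
    ∑ i, ((1 - κ) * (u i).re ^ 2 + (1 + κ) * (u i).im ^ 2) =
      (star u ⬝ᵥ u).re - κ * (u ⬝ᵥ u).re := by
  rw [re_star_dotProduct, re_dotProduct, Finset.mul_sum, ← Finset.sum_sub_distrib]
  exact Finset.sum_congr rfl fun i _ => by ring

lemma re_star_dotProduct_comm {l : Type*} [Fintype l] (u v : l → ℂ) :
    (star u ⬝ᵥ v).re = (star v ⬝ᵥ u).re := by
  rw [re_star_dotProduct, re_star_dotProduct]
  exact Finset.sum_congr rfl fun i _ => by ring

lemma re_star_dotProduct_I_smul {l : Type*} [Fintype l] (u : l → ℂ) :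
    (star u ⬝ᵥ (Complex.I • u)).re = 0 := by
  rw [re_star_dotProduct]
  refine Finset.sum_eq_zero fun i _ => ?_
  simp only [Pi.smul_apply, smul_eq_mul, Complex.mul_re, Complex.mul_im, Complex.I_re,
    Complex.I_im]
  ring

lemma star_I_smul_dotProduct {l : Type*} [Fintype l] (u v : l → ℂ) :
    star (Complex.I • u) ⬝ᵥ (Complex.I • v) = star u ⬝ᵥ v := by
  rw [star_smul, smul_dotProduct, dotProduct_smul, smul_smul]
  simp

/-- The left side is twice `|Re (ζ f)|²` for `ζ = x - iy`. -/
lemma two_mul_combination_dotProduct_self {l : Type*} [Fintype l] (f : l → ℂ) (x y : ℝ) :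
    2 * ((x • (fun i => (f i).re) + y • fun i => (f i).im) ⬝ᵥ
        (x • (fun i => (f i).re) + y • fun i => (f i).im)) =
      (x ^ 2 + y ^ 2) * (star f ⬝ᵥ f).re + ((⟨x, -y⟩ : ℂ) ^ 2 * (f ⬝ᵥ f)).re := by
  rw [← smul_eq_mul (_ ^ 2), ← smul_dotProduct, re_star_dotProduct, re_dotProduct, dotProduct,
    Finset.mul_sum, Finset.mul_sum, ← Finset.sum_add_distrib]
  refine Finset.sum_congr rfl fun i _ => ?_
  simp only [Pi.add_apply, Pi.smul_apply, smul_eq_mul, pow_two, Complex.mul_re, Complex.mul_im]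
  ring

lemma twisted_self_eq (ρ κ : ℝ) (M : Matrix q ι ℂ) (N : Matrix r ι ℂ) (v : EuclideanSpace ℂ ι) :
    twisted (hermForm ρ M N) (symForm ρ M N) κ v v =
      ρ ^ 2 * ∑ i, ((1 - κ) * ((N *ᵥ v) i).re ^ 2 + (1 + κ) * ((N *ᵥ v) i).im ^ 2) -
        ∑ i, ((1 - κ) * ((M *ᵥ v) i).re ^ 2 + (1 + κ) * ((M *ᵥ v) i).im ^ 2) := by
  rw [sum_twisted_eq, sum_twisted_eq, twisted_apply, hermForm_apply, symForm_apply, Complex.sub_re,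
    ← Complex.ofReal_pow, Complex.re_ofReal_mul]
  ring

lemma symForm_I_smul (ρ : ℝ) (M : Matrix q ι ℂ) (N : Matrix r ι ℂ) (v w : EuclideanSpace ℂ ι) :
    symForm ρ M N (Complex.I • v) w = Complex.I * symForm ρ M N v w := by
  simp only [symForm_apply, WithLp.ofLp_smul, mulVec_smul, smul_dotProduct, smul_eq_mul]
  ring

lemma hermForm_I_smul_self (ρ : ℝ) (M : Matrix q ι ℂ) (N : Matrix r ι ℂ)
    (v : EuclideanSpace ℂ ι) :
    hermForm ρ M N (Complex.I • v) (Complex.I • v) = hermForm ρ M N v v := by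
  simp only [hermForm_apply, WithLp.ofLp_smul, mulVec_smul, star_I_smul_dotProduct]

lemma hermForm_I_smul (ρ : ℝ) (M : Matrix q ι ℂ) (N : Matrix r ι ℂ) (v : EuclideanSpace ℂ ι) :
    hermForm ρ M N v (Complex.I • v) = 0 := by
  simp only [hermForm_apply, WithLp.ofLp_smul, mulVec_smul, re_star_dotProduct_I_smul]
  ring

lemma hermForm_comm (ρ : ℝ) (M : Matrix q ι ℂ) (N : Matrix r ι ℂ) (v w : EuclideanSpace ℂ ι) :
    hermForm ρ M N v w = hermForm ρ M N w v := by
  rw [hermForm_apply, hermForm_apply, re_star_dotProduct_comm,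
    re_star_dotProduct_comm (M *ᵥ v.ofLp)]

lemma symForm_comm (ρ : ℝ) (M : Matrix q ι ℂ) (N : Matrix r ι ℂ) (v w : EuclideanSpace ℂ ι) :
    symForm ρ M N v w = symForm ρ M N w v := by
  rw [symForm_apply, symForm_apply, dotProduct_comm, dotProduct_comm (M *ᵥ v.ofLp)]

/-- The bound `|ρ²(Nd)ᵀ(Nd) - (Md)ᵀ(Md)| ≤ ρ²|Nd|² - |Md|²` says that every real combination of the
real and imaginary parts of `M d` is at most `ρ` times as long as the same combination for `N d`. -/
lemma combination_le_of_norm_symForm_le {ρ : ℝ} {M : Matrix q ι ℂ} {N : Matrix r ι ℂ}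
    {d : EuclideanSpace ℂ ι} (h : ‖symForm ρ M N d d‖ ≤ hermForm ρ M N d d) (x y : ℝ) :
    let u := N *ᵥ d
    let v := M *ᵥ d
    (x • (fun i => (v i).re) + y • fun i => (v i).im) ⬝ᵥ
        (x • (fun i => (v i).re) + y • fun i => (v i).im) ≤
      ρ ^ 2 * ((x • (fun i => (u i).re) + y • fun i => (u i).im) ⬝ᵥ
        (x • (fun i => (u i).re) + y • fun i => (u i).im)) := by
  intro u v
  set ζ : ℂ := ⟨x, -y⟩ with hζ
  have hku := two_mul_combination_dotProduct_self u x y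
  have hkv := two_mul_combination_dotProduct_self v x y
  rw [← hζ] at hku hkv
  have h1 : (ζ ^ 2 * symForm ρ M N d d).re =
      ρ ^ 2 * (ζ ^ 2 * (u ⬝ᵥ u)).re - (ζ ^ 2 * (v ⬝ᵥ v)).re := by
    rw [symForm_apply, ← Complex.re_ofReal_mul, ← Complex.sub_re]
    congr 1
    push_cast
    ring
  have h2 : hermForm ρ M N d d = ρ ^ 2 * (star u ⬝ᵥ u).re - (star v ⬝ᵥ v).re := rfl
  have h3 : -((x ^ 2 + y ^ 2) * ‖symForm ρ M N d d‖) ≤ (ζ ^ 2 * symForm ρ M N d d).re := by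
    have h4 := Complex.abs_re_le_norm (ζ ^ 2 * symForm ρ M N d d)
    have h5 : ‖ζ ^ 2‖ = x ^ 2 + y ^ 2 := by
      rw [norm_pow, ← Complex.normSq_eq_norm_sq, hζ, Complex.normSq_mk]; ring
    rw [norm_mul, h5] at h4
    exact (abs_le.1 h4).1
  have h6 := mul_le_mul_of_nonneg_left h (add_nonneg (sq_nonneg x) (sq_nonneg y))
  rw [h1] at h3
  rw [h2] at h6
  nlinarith

lemma sum_weighted_sq_eq {l : Type*} [Fintype l] {κ : ℝ} (hκ : 1 - κ ≠ 0) (f : l → ℂ) :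
    ∑ i, ((1 - κ) * (f i).re ^ 2 + (1 + κ) * (f i).im ^ 2) =
      (1 - κ) * ∑ i, ((f i).re ^ 2 + (1 + κ) / (1 - κ) * (f i).im ^ 2) := by
  rw [Finset.mul_sum]
  refine Finset.sum_congr rfl fun i _ => ?_
  field_simp

lemma IsSolution.ofReal_spectralNorm_eq [DecidableEq q] [DecidableEq r] {M : Matrix q ι ℂ}
    {N : Matrix r ι ℂ} {Δ : Matrix q r ℝ} (h : IsSolution M N Δ) : ENNReal.ofReal (spectralNorm Δ) = minNorm M N :=
  le_antisymm (le_iInf₂ fun Δ' hΔ' => ENNReal.ofReal_le_ofReal (h.2 Δ' hΔ')) (iInf₂_le Δ h.1)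

variable [DecidableEq ι]

/-- The parameters are related by `γ² = (1 - κ) / (1 + κ)`: then `|Π(γ, M) x|²` is, up to a positive
factor, `|M z|² - κ Re ((M z)ᵀ(M z))` for `z = complexify γ x`. -/
lemma exists_isNonnegFrame {ρ : ℝ} (hρ : 0 ≤ ρ) {M : Matrix q ι ℂ} {N : Matrix r ι ℂ}
    (hker : ∀ d, M *ᵥ d = 0 → N *ᵥ d = 0 → d = 0) {i : ℕ} (hi : 2 * Fintype.card ι = i + 1)
    (hgsv : ∀ γ ∈ Set.Ioc (0 : ℝ) 1,
      gsv i (realBlock γ M) (realBlock γ N) ≤ ENNReal.ofReal ρ)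
    {κ : ℝ} (hκ : κ ∈ Set.Ico (0 : ℝ) 1) :
    ∃ u v, IsNonnegFrame (twisted (hermForm ρ M N) (symForm ρ M N) κ) u v := by
  have hm : 0 < 1 - κ := by linarith [hκ.2]
  have hp : 0 < 1 + κ := by linarith [hκ.1]
  set γ := √((1 - κ) / (1 + κ)) with hγdef
  have hγ : 0 < γ := Real.sqrt_pos.2 (div_pos hm hp)
  have hγ1 : γ ≤ 1 := by
    rw [hγdef, Real.sqrt_le_one, div_le_one hp]
    linarith [hκ.1]
  have hγ2 : (γ ^ 2)⁻¹ = (1 + κ) / (1 - κ) := by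
    rw [hγdef, Real.sq_sqrt (div_pos hm hp).le, inv_div]
  obtain ⟨x₁, x₂, hind, hle⟩ := exists_plane_of_gsv_le (i := i) hρ
    (fun x h1 h2 => complexify_eq_zero hγ.ne' (hker _ (mulVec_complexify_eq_zero hγ.ne' h1)
      (mulVec_complexify_eq_zero hγ.ne' h2)))
    (by rw [Fintype.card_sum]; omega) (by omega) (hgsv γ ⟨hγ, hγ1⟩)
  have hcomb : ∀ a b : ℝ, a • WithLp.toLp 2 (complexify γ x₁) + b • WithLp.toLp 2 (complexify γ x₂) =
      WithLp.toLp 2 (complexify γ (a • x₁ + b • x₂)) := by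
    intro a b
    rw [complexify_combination]
    rfl
  refine ⟨WithLp.toLp 2 (complexify γ x₁), WithLp.toLp 2 (complexify γ x₂), fun a b h0 => ?_,
    fun a b => ?_⟩
  · rw [hcomb] at h0
    exact hind a b (complexify_eq_zero hγ.ne' (congrArg WithLp.ofLp h0))
  · have h := hle a b
    rw [realBlock_mulVec_self hγ.ne', realBlock_mulVec_self hγ.ne', hγ2] at h
    rw [hcomb, twisted_self_eq]
    set z := complexify γ (a • x₁ + b • x₂) with hz
    rw [sum_weighted_sq_eq hm.ne', sum_weighted_sq_eq hm.ne']
    nlinarith [mul_le_mul_of_nonneg_left h hm.le]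

variable [DecidableEq q] [DecidableEq r]

/-- If `Δ N d = M d`, then `Δ` maps `Re (N z)` to `Re (M z)` and `Im (N z)` to `Im (M z)` for all
complex multiples `z` of `d`. Hence the inequality `|Π(γ, M) x| ≤ ‖Δ‖ |Π(γ, N) x|` holds on the
real plane that corresponds to the complex line of `d`. -/
lemma gsv_le_spectralNorm {M : Matrix q ι ℂ} {N : Matrix r ι ℂ} {Δ : Matrix q r ℝ}
    (hΔ : Δ ∈ feasible M N) {γ : ℝ} (hγ : γ ≠ 0) {i : ℕ} (hi : 2 * Fintype.card ι ≤ i + 1) :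
    gsv i (realBlock γ M) (realBlock γ N) ≤ ENNReal.ofReal (spectralNorm Δ) := by
  obtain ⟨d, hd0, hd⟩ := hΔ
  obtain ⟨x₁, hx₁⟩ := exists_complexify_eq hγ d
  obtain ⟨x₂, hx₂⟩ := exists_complexify_eq hγ (Complex.I • d)
  have hcomb : ∀ a b : ℝ, complexify γ (a • x₁ + b • x₂) = ((a : ℂ) + b * Complex.I) • d := by
    intro a b
    rw [complexify_combination, hx₁, hx₂, smul_smul, add_smul]
  refine gsv_le (x₁ := x₁) (x₂ := x₂) (spectralNorm_nonneg Δ) (fun a b h0 => ?_) (fun a b => ?_)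
    (by rw [Fintype.card_sum]; omega)
  · have h1 := hcomb a b
    rw [h0] at h1
    have h2 : ((a : ℂ) + b * Complex.I) • d = 0 := by
      rw [← h1]
      ext i
      apply Complex.ext <;> simp [complexify]
    have h3 := (smul_eq_zero.1 h2).resolve_right hd0
    have hre := congrArg Complex.re h3
    have him := congrArg Complex.im h3
    simp at hre him
    exact ⟨hre, him⟩
  · rw [realBlock_mulVec_self hγ, realBlock_mulVec_self hγ, hcomb]
    set z := ((a : ℂ) + b * Complex.I) • d with hz
    have hMz : M *ᵥ z = Δ.map Complex.ofReal *ᵥ (N *ᵥ z) := by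
      rw [hz, mulVec_smul, ← hd, mulVec_mulVec, mulVec_smul]
    have hre : ∀ i, ((M *ᵥ z) i).re = (Δ *ᵥ fun j => ((N *ᵥ z) j).re) i := by
      intro i
      rw [hMz]
      simp [mulVec, dotProduct]
    have him : ∀ i, ((M *ᵥ z) i).im = (Δ *ᵥ fun j => ((N *ᵥ z) j).im) i := by
      intro i
      rw [hMz]
      simp [mulVec, dotProduct]
    have h1 := dotProduct_mulVec_self_le Δ fun j => ((N *ᵥ z) j).re
    have h2 := dotProduct_mulVec_self_le Δ fun j => ((N *ᵥ z) j).im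
    simp only [dotProduct, ← pow_two] at h1 h2
    simp only [hre, him, Finset.sum_add_distrib, ← Finset.mul_sum]
    have hγ2 : 0 < (γ ^ 2)⁻¹ := by positivity
    nlinarith [mul_le_mul_of_nonneg_left h2 hγ2.le]

/-- The lower bound by generalized singular values is sharp: `exists_norm_le` yields the vector `d`
and `exists_spectralNorm_le` the matrix. -/
lemma exists_feasible_of_gsv_le [Nonempty ι] {ρ : ℝ} (hρ : 0 ≤ ρ) {M : Matrix q ι ℂ}
    {N : Matrix r ι ℂ} (hgsv : ∀ γ ∈ Set.Ioc (0 : ℝ) 1,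
      gsv (2 * Fintype.card ι - 1) (realBlock γ M) (realBlock γ N) ≤ ENNReal.ofReal ρ) :
    ∃ Δ ∈ feasible M N, spectralNorm Δ ≤ ρ := by
  by_cases hker : ∀ d, M *ᵥ d = 0 → N *ᵥ d = 0 → d = 0
  · have hcard : 0 < Fintype.card ι := Fintype.card_pos
    obtain ⟨d, hd0, hd⟩ := exists_norm_le (hermForm_comm ρ M N) (symForm_comm ρ M N)
      (hermForm_I_smul_self ρ M N) (hermForm_I_smul ρ M N) (symForm_I_smul ρ M N)
      (fun κ hκ => exists_isNonnegFrame hρ hker (by omega) hgsv hκ)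
    obtain ⟨Δ, hΔ, h1, h2⟩ := exists_spectralNorm_le hρ _ _ _ _
      (combination_le_of_norm_symForm_le hd)
    refine ⟨Δ, ⟨d.ofLp, fun h0 => hd0 (congrArg (WithLp.toLp 2) h0), ?_⟩, hΔ⟩
    rw [← mulVec_mulVec]
    ext i
    apply Complex.ext
    · rw [← congrFun h1 i]
      simp [mulVec, dotProduct]
    · rw [← congrFun h2 i]
      simp [mulVec, dotProduct]
  · -- On a common null vector of `M` and `N` the zero matrix will do.
    push Not at hker
    obtain ⟨d, h1, h2, hd0⟩ := hker
    refine ⟨0, ⟨d, hd0, ?_⟩, ?_⟩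
    · rw [← mulVec_mulVec, h1, h2, mulVec_zero]
    · simpa [spectralNorm] using hρ

/-- The minimal norm is the supremum, and it is attained if it is finite. -/
lemma minNorm_eq_and_exists_isSolution [Nonempty ι] (M : Matrix q ι ℂ) (N : Matrix r ι ℂ) :
    minNorm M N = (⨆ γ ∈ Set.Ioc (0 : ℝ) 1,
      gsv (2 * Fintype.card ι - 1) (realBlock γ M) (realBlock γ N)) ∧
      ((feasible M N).Nonempty → ∃ Δ, IsSolution M N Δ) := by
  set σ : ℝ≥0∞ := ⨆ γ ∈ Set.Ioc (0 : ℝ) 1,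
    gsv (2 * Fintype.card ι - 1) (realBlock γ M) (realBlock γ N) with hσ
  have hle : ∀ Δ ∈ feasible M N, σ ≤ ENNReal.ofReal (spectralNorm Δ) := fun Δ hΔ =>
    iSup₂_le fun γ hγ => gsv_le_spectralNorm hΔ hγ.1.ne' (by omega)
  have hex : σ ≠ ⊤ → ∃ Δ ∈ feasible M N, spectralNorm Δ ≤ σ.toReal := fun htop =>
    exists_feasible_of_gsv_le ENNReal.toReal_nonneg fun γ hγ => by
      rw [ENNReal.ofReal_toReal htop]
      exact le_iSup₂ (f := fun γ (_ : γ ∈ Set.Ioc (0 : ℝ) 1) =>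
        gsv (2 * Fintype.card ι - 1) (realBlock γ M) (realBlock γ N)) γ hγ
  constructor
  · refine le_antisymm ?_ (le_iInf₂ hle)
    by_cases htop : σ = ⊤
    · rw [htop]; exact le_top
    · obtain ⟨Δ, hΔ, h1⟩ := hex htop
      exact (iInf₂_le Δ hΔ).trans (ENNReal.ofReal_le_of_le_toReal h1)
  · rintro ⟨Δ₀, hΔ₀⟩
    obtain ⟨Δ, hΔ, h1⟩ := hex (ne_top_of_le_ne_top ENNReal.ofReal_ne_top (hle Δ₀ hΔ₀))
    exact ⟨Δ, hΔ, fun Δ' hΔ' =>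
      h1.trans (ENNReal.toReal_le_of_le_ofReal (spectralNorm_nonneg Δ') (hle Δ' hΔ'))⟩

end RealBlock

end OpacityPerturbation

end

theorem lemma3 {n m p k t : ℕ}
    (A : Matrix (Fin n) (Fin n) ℝ) (B : Matrix (Fin n) (Fin p) ℝ)
    (C : Matrix (Fin m) (Fin n) ℝ) (D : Matrix (Fin m) (Fin p) ℝ)
    (E : Matrix (Fin n ⊕ Fin m) (Fin n ⊕ Fin m) ℝ)
    (G : Matrix (Fin n ⊕ Fin p) (Fin n ⊕ Fin p) ℝ)
    (hE : OpacityPerturbation.IsBinaryDiagonal E) (hG : OpacityPerturbation.IsBinaryDiagonal G)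
    (s : ℂ)
    (Lα : Matrix (OpacityPerturbation.Selected E) (Fin n ⊕ Fin p) ℂ)
    (hLα : Lα = OpacityPerturbation.alphaPart E (OpacityPerturbation.pencil A B C D s))
    (Lβ : Matrix (OpacityPerturbation.Unselected E) (Fin n ⊕ Fin p) ℂ)
    (hLβ : Lβ = OpacityPerturbation.betaPart E (OpacityPerturbation.pencil A B C D s))
    (Q₁ : Matrix (Fin n ⊕ Fin p) (Fin k) ℂ) (Q₂ : Matrix (Fin n ⊕ Fin p) (Fin t) ℂ)
    (R₁ : Matrix (Fin k) (OpacityPerturbation.Unselected E) ℂ)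
    (hQR : OpacityPerturbation.IsQR Lβ Q₁ Q₂ R₁)
    (Q₂α : Matrix (OpacityPerturbation.Selected G) (Fin t) ℂ)
    (hQ₂α : Q₂α = OpacityPerturbation.selector G * Q₂)
    (hne : Q₂α ≠ 0) (hrank : Lβ.rank < n + p)
    (ht : t ≤ Fintype.card (OpacityPerturbation.Selected E))
    (δ : ℕ) (hδ : δ = min (Fintype.card (OpacityPerturbation.Selected E)) t) :
    OpacityPerturbation.minNorm (Lα * Q₂) Q₂α =
        (⨆ γ ∈ Set.Ioc (0 : ℝ) 1, OpacityPerturbation.gsv (2 * δ - 1)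
          (OpacityPerturbation.realBlock γ (Lα * Q₂)) (OpacityPerturbation.realBlock γ Q₂α)) ∧
      (∀ Δ, OpacityPerturbation.IsSolution (Lα * Q₂) Q₂α Δ →
        ENNReal.ofReal (OpacityPerturbation.spectralNorm Δ) =
          ⨆ γ ∈ Set.Ioc (0 : ℝ) 1, OpacityPerturbation.gsv (2 * δ - 1)
            (OpacityPerturbation.realBlock γ (Lα * Q₂)) (OpacityPerturbation.realBlock γ Q₂α)) ∧
      ((OpacityPerturbation.feasible (Lα * Q₂) Q₂α).Nonempty →
        ∃ Δ, OpacityPerturbation.IsSolution (Lα * Q₂) Q₂α Δ) := by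
  -- `Q₂α ≠ 0` leaves no room for `t = 0`, where `2 * δ - 1` would be truncated.
  have hne' : Nonempty (Fin t) := by
    by_contra h
    rw [not_nonempty_iff] at h
    exact hne (Matrix.ext fun _ j => isEmptyElim j)
  have hδt : δ = Fintype.card (Fin t) := by rw [hδ, min_eq_right ht, Fintype.card_fin]
  subst hδt
  obtain ⟨h1, h2⟩ := OpacityPerturbation.minNorm_eq_and_exists_isSolution (Lα * Q₂) Q₂α
  exact ⟨h1, fun Δ hΔ => hΔ.ofReal_spectralNorm_eq.trans h1, h2⟩
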